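/- Let $V$ be a countable set and let $E$ be a collection of finite subsets of $V$, each with at least two elements, such that every $x\in V$ belongs to only finitely many $e\in E$. Let $(S,\mathcal S)$ be a standard Borel space with a probability measure $\chi$, let $\Sigma=S^V$ with its product $\sigma$-algebra $\mathcal F$, and for $\Delta\subset V$ let $\mathcal F_\Delta$ be the $\sigma$-algebra generated by the coordinates $\sigma_x$, $x\in\Delta$. For each $e\in E$ let $h_e:\Sigma\to[0,\infty)$ be $\mathcal F_e$-measurable with $0<m_e\le h_e\le M_e<\infty$, and put $\delta(e)=\log M_e-\log m_e$. For finite nonempty $\Lambda\subset V$ let $h_\Lambda=\prod_{e\in E,\,e\cap\Lambda\ne\varnothing}h_e$, let $\chi_\Lambda(\cdot|\sigma)=\chi^{\Lambda}\times\delta_{\sigma_{\Lambda^c}}$, and let $\gamma_\Lambda(\cdot|\sigma)=\frac{h_\Lambda}{\chi_\Lambda(h_\Lambda)}\,\chi_\Lambda(\cdot|\sigma)$. Let $\mathcal G(\gamma)$ be the set of probability measures $\mu$ on $(\Sigma,\mathcal F)$ such that $\mu(A|\mathcal F_{\Lambda^c})=\gamma_\Lambda(A|\cdot)$ $\mu$-a.s.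 for all $A\in\mathcal F$ and all finite nonempty $\Lambda\subset V$. Let $L$ be the line graph: its vertices are the elements of $E$, and distinct $e,e'\in E$ are adjacent iff $e\cap e'\neq\varnothing$; let $n_L(e)$ be the degree of $e$ in $L$ and $d_L$ the graph distance. For $e\in E$ and $r\in\mathbb N$ let $\mathcal A_r(e)$ be the family of finite sets $A\subset E$ that contain $e$, generate a connected subgraph of $L$, satisfy $d_L(e,e')\le r$ for all $e'\in A$, and have $|A|\ge r+1$. Let $\Theta_r(e)$ be the family of simple paths $\vartheta$ in $L$ starting at $e$ whose vertex set $A_\vartheta$ belongs to $\mathcal A_r(e)$. Put $$\mathfrak D(\vartheta)=\frac1{|A_\vartheta|}\sum_{e'\in A_\vartheta}\log\bigl(e^{2\delta(e')}-1\bigr)\in[-\infty,\infty),\qquad \log 0=-\infty .$$ Let $g:\mathbb N\to[0,\infty)$ be strictly increasing with $g(n)\ge\log n$ for all $n\geq 1$, and let $\bar a>0$. Suppose that $L$ is $(g,\bar a)$-tempered: for each $e\in E$ there is a strictly increasing sequence $(N_k)_{k}=(N_k(e))_{k}$ of positive integers such that $$\sup_{e\in E}\ \sup_{k}\ \max_{A\in\mathcal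 A_{N_k}(e)}\ \frac1{|A|}\sum_{e'\in A}g\bigl(n_L(e')\bigr)=\bar a .$$ Suppose further that, for these sequences and some $\epsilon>0$, $$\sup_{e\in E}\ \sup_{k}\ \max_{\vartheta\in\Theta_{N_k}(e)}\mathfrak D(\vartheta)\le-(\bar a+\epsilon).$$ Then $\mathcal G(\gamma)$ is a singleton, and its unique element $\mu$ is globally Markov: for every $\Delta\subset V$ and every $A\in\mathcal F_\Delta$, $$\mu(A|\mathcal F_{\Delta^c})=\mu(A|\mathcal F_{\partial\Delta})\quad\mu\text{-a.s.},$$ where $\partial\Delta=\{y\in\Delta^c:\ \exists x\in\Delta\ \exists e\in E\ \ \{x,y\}\subset e\}$. -/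

import Mathlib

open MeasureTheory ProbabilityTheory
open scoped ENNReal

noncomputable section

/-! ### Tempered graphs -/

namespace TemperedGraph

variable {α : Type*} (G : SimpleGraph α)

/-- The average `𝔊(A; g) = |A|⁻¹ ∑_{x ∈ A} g (n_G x)`, where `n_G x` is the degree of `x`
(meaningful for locally finite `G`). -/
def degreeAverage (g : ℕ → ℝ) (A : Finset α) : ℝ :=
  (A.card : ℝ)⁻¹ * ∑ x ∈ A, g (G.neighborSet x).ncard

/-- The closed ball `B_r(x)` of the graph metric; points in other components are at distance
`⊤`. -/
def ball (r : ℕ) (x : α) : Set α := {y | G.edist x y ≤ r}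

/-- `𝒜_r(x)`: the animals (finite vertex sets generating a connected subgraph) which contain `x`,
lie in `B_r(x)` and have at least `r + 1` elements. -/
def animals (r : ℕ) (x : α) : Set (Finset α) :=
  {A | (A : Set α) ⊆ ball G r x ∧ x ∈ A ∧ r + 1 ≤ A.card ∧ (G.induce (A : Set α)).Connected}

open Classical in
/-- The animal `A_ϑ`: the set of vertices of the path `ϑ`. -/
def pathAnimal {x : α} (ϑ : Σ y, G.Walk x y) : Finset α := ϑ.2.support.toFinset

/-- `Θ_r(x)`: the simple paths `ϑ` originating at `x` with `A_ϑ ∈ 𝒜_r(x)`. -/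
def simplePaths (r : ℕ) (x : α) : Set (Σ y, G.Walk x y) :=
  {ϑ | ϑ.2.IsPath ∧ pathAnimal G ϑ ∈ animals G r x}

/-- `G` is `(g, a)`-tempered, with witnessing sequences `(N x k)_k`, one for each vertex `x`.
The suprema are taken in `[-∞, +∞]`. -/
def IsTemperedAlong (g : ℕ → ℝ) (a : ℝ) (N : α → ℕ → ℕ) : Prop :=
  (∀ x, StrictMono (N x)) ∧ (∀ x k, 1 ≤ N x k) ∧
    (⨆ x, ⨆ k, ⨆ A ∈ animals G (N x k) x, (degreeAverage G g A : EReal)) = (a : EReal)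

end TemperedGraph

/-! ### Dependence hypergraphs -/

/-- A locally finite hypergraph whose vertex set is all of `V` and whose edges are finite sets
with at least two elements. -/
structure DependenceHypergraph (V : Type*) extends Hypergraph V where
  vertexSet_eq : vertexSet = Set.univ
  finite_edge : ∀ e ∈ edgeSet, e.Finite
  nontrivial_edge : ∀ e ∈ edgeSet, e.Nontrivial
  locallyFinite : ∀ x, {e ∈ edgeSet | x ∈ e}.Finite

namespace DependenceHypergraph

variable {V : Type*} (H : DependenceHypergraph V)

/-- The type of hyperedges. -/
abbrev Edge : Type _ := ↥H.edgeSet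

/-- The line graph `L(H)`: its vertices are the hyperedges, and two distinct hyperedges are
adjacent if they intersect. -/
def lineGraph : SimpleGraph H.Edge where
  Adj e e' := e ≠ e' ∧ ((e : Set V) ∩ (e' : Set V)).Nonempty
  symm := ⟨fun _ _ h => ⟨h.1.symm, by rw [Set.inter_comm]; exact h.2⟩⟩
  loopless := ⟨fun _ h => h.1 rfl⟩

/-- The outer boundary `∂Δ` of an arbitrary set of vertices `Δ`. -/
def boundary (Δ : Set V) : Set V :=
  {y | y ∉ Δ ∧ ∃ x ∈ Δ, ∃ e ∈ H.edgeSet, x ∈ e ∧ y ∈ e}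

theorem finite_touching (Λ : Finset V) :
    {e : H.Edge | ((e : Set V) ∩ (Λ : Set V)).Nonempty}.Finite := by
  have h1 : (⋃ x ∈ (Λ : Set V), {e ∈ H.edgeSet | x ∈ e}).Finite :=
    Λ.finite_toSet.biUnion fun x _ => H.locallyFinite x
  refine Set.Finite.of_finite_image (f := Subtype.val) (h1.subset ?_)
    Subtype.val_injective.injOn
  rintro _ ⟨e, ⟨x, hxe, hxΛ⟩, rfl⟩
  exact Set.mem_biUnion hxΛ ⟨e.2, hxe⟩

/-- `E_Λ`: the finite set of hyperedges which intersect `Λ`. -/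
def touching (Λ : Finset V) : Finset H.Edge := (H.finite_touching Λ).toFinset

end DependenceHypergraph

/-! ### Specifications and random fields -/

namespace RandomField

variable {V S : Type*} [MeasurableSpace S]

open Classical in
/-- The configuration equal to `ζ` on `Λ` and to `σ` off `Λ`. -/
def glue (Λ : Finset V) (σ : V → S) (ζ : Λ → S) : V → S :=
  fun x => if hx : x ∈ Λ then ζ ⟨x, hx⟩ else σ x

/-- The independent kernel `χ_Λ(· | σ) = χ^Λ × δ_{σ_{Λᶜ}}`. -/
def indepKernel (χ : Measure S) (Λ : Finset V) (σ : V → S) : Measure (V → S) :=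
  (Measure.pi fun _ : Λ => χ).map (glue Λ σ)

/-- The set of all probability measures specified by `γ`, i.e. such that
`μ(A | ℱ_{Λᶜ}) = γ_Λ(A | ·)` almost surely, for all events `A` and nonempty finite `Λ`. -/
def specifiedBy (γ : Finset V → (V → S) → Measure (V → S)) : Set (Measure (V → S)) :=
  {μ | IsProbabilityMeasure μ ∧ ∀ Λ : Finset V, Λ.Nonempty → ∀ A : Set (V → S),
    MeasurableSet A →
      μ⟦A | cylinderEvents (X := fun _ : V => S) (Λ : Set V)ᶜ⟧ =ᵐ[μ] fun σ => (γ Λ σ).real A}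

/-- `μ` is globally Markov with respect to `H`: given `ℱ_{Δᶜ}`, the conditional law of the field
in `Δ` only depends on the field on `∂Δ`, for every (possibly infinite) `Δ ⊆ V`. -/
def IsGloballyMarkov (H : DependenceHypergraph V) (μ : Measure (V → S)) : Prop :=
  ∀ Δ : Set V, ∀ A : Set (V → S),
    MeasurableSet[cylinderEvents (X := fun _ : V => S) Δ] A →
      μ⟦A | cylinderEvents (X := fun _ : V => S) Δᶜ⟧ =ᵐ[μ]
        μ⟦A | cylinderEvents (X := fun _ : V => S) (H.boundary Δ)⟧

/-- The assumption on `(h_e)`: each `h_e` is `ℱ_e`-measurable and takes values in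
`[m_e, M_e]`, with `m_e > 0`. -/
structure IsBoundedFamily (H : DependenceHypergraph V) (h : H.Edge → (V → S) → ℝ)
    (m M : H.Edge → ℝ) : Prop where
  measurable : ∀ e : H.Edge,
    Measurable[cylinderEvents (X := fun _ : V => S) (e : Set V)] (h e)
  lower_pos : ∀ e, 0 < m e
  lower_le : ∀ e σ, m e ≤ h e σ
  le_upper : ∀ e σ, h e σ ≤ M e

/-- The pre-modification `h_Λ = ∏_{e ∈ E_Λ} h_e`. -/
def preModification (H : DependenceHypergraph V) (h : H.Edge → (V → S) → ℝ)
    (Λ : Finset V) (σ : V → S) : ℝ :=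
  ∏ e ∈ H.touching Λ, h e σ

/-- The `χ`-modification `ρ_Λ = h_Λ / χ_Λ(h_Λ)`. -/
def modification (χ : Measure S) (H : DependenceHypergraph V) (h : H.Edge → (V → S) → ℝ)
    (Λ : Finset V) (σ : V → S) : ℝ :=
  preModification H h Λ σ / ∫ η, preModification H h Λ η ∂(indepKernel χ Λ σ)

/-- The specification `γ_Λ(· | σ) = ρ_Λ χ_Λ(· | σ)`. -/
def specification (χ : Measure S) (H : DependenceHypergraph V) (h : H.Edge → (V → S) → ℝ)
    (Λ : Finset V) (σ : V → S) : Measure (V → S) :=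
  (indepKernel χ Λ σ).withDensity fun η => ENNReal.ofReal (modification χ H h Λ η)

/-- The logarithmic oscillation `δ(e) = log M_e - log m_e`. -/
def oscillation {H : DependenceHypergraph V} (m M : H.Edge → ℝ) (e : H.Edge) : ℝ :=
  Real.log (M e) - Real.log (m e)

/-- The average `𝔇 = |A|⁻¹ ∑_{e ∈ A} log (exp (2 δ(e)) - 1)`, with `log 0 = -∞`; the average
is therefore `-∞` as soon as `δ(e) = 0` for some `e ∈ A`. -/
def weightAverage {H : DependenceHypergraph V} (δ : H.Edge → ℝ) (A : Finset H.Edge) : EReal :=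
  (((A.card : ℝ)⁻¹ : ℝ) : EReal) *
    ∑ e ∈ A, ENNReal.log (ENNReal.ofReal (Real.exp (2 * δ e) - 1))

end RandomField

end

/-! Everything rests on one estimate: the law under `γ_Λ` of a finite set of sites `Δ` hardly
depends on the boundary condition, uniformly (`HasUniformDecay`). To compare boundary conditions `ξ`
and `η`, take independent samples `σ`, `σ'` of `χ_Λ(·|ξ)` and `χ_Λ(·|η)`, and write `h_e(σ) h_e(σ')
= m_e² (1 + K_e)` with `0 ≤ K_e ≤ exp (2 δ(e)) - 1`. Expanding `∏ (1 + K_e)` over sets `B` of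
hyperedges, consider the cluster of `Δ` in `B`. If `ξ` and `η` agree on the part of it outside `Λ`,
exchanging the two samples on the cluster preserves their joint law and every `K_e` with `e ∈ B`,
but reverses the sign of `1_A(σ) - 1_A(σ')`; the term vanishes. Every other `B` contains a long
simple path of the line graph starting at a hyperedge that touches `Δ` (`abs_specification_sub_le`,
`cluster_subset`).

A union bound leaves the sum over simple paths of length `N = N_k(e)` of `∏ (exp (2 δ) - 1)`. Each
such path has `N + 1` vertices, so its weight is at most `exp (-(a + ε)(N + 1))`, while the product
of its degrees is at most `exp (a (N + 1))`. Since the random-walk weights `∏ 1 / max 1 n_L` of the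
walks from `e` sum to at most `1`, the path sum is at most `exp (-ε (N + 1))`
(`sum_pathLists_le_exp`), which tends to `0` with `k`.

Uniqueness is then immediate. For existence, the `γ_Λ(·|ξ)` are Cauchy on local events; compactness,
after embedding `S` in the Cantor space, produces a limit, and the DLR equations pass to it because
`γ_Λ(B|·)` is local for local `B`. For the global Markov property, the estimate is applied in `Λ =
Λ₀ ∩ Δ` to configurations that agree off `Δ`: `γ_Λ(B|·)` is then uniformly close to a function of
the configuration on `∂Δ`. -/

noncomputable section

/-! ### Weighted counting of simple paths in tempered graphs -/

namespace TemperedGraph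

variable {α : Type*} {G : SimpleGraph α}

open Classical in
/-- The vertex lists of the walks of length `n` starting at a given vertex of a locally finite
graph. -/
def walkLists (hG : ∀ x, (G.neighborSet x).Finite) : ℕ → α → Finset (List α)
  | 0, x => {[x]}
  | n + 1, x => (hG x).toFinset.biUnion fun y => (walkLists hG n y).image (List.cons x)

theorem support_mem_walkLists (hG : ∀ x, (G.neighborSet x).Finite) {x y : α} (p : G.Walk x y) :
    p.support ∈ walkLists hG p.length x := by
  induction p with
  | nil => simp [walkLists]
  | cons h p ih =>
    simp only [SimpleGraph.Walk.length_cons, walkLists, Finset.mem_biUnion, Finset.mem_image]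
    exact ⟨_, by simpa using h, _, ih, rfl⟩

theorem head?_of_mem_walkLists (hG : ∀ x, (G.neighborSet x).Finite) {n : ℕ} {x : α} {l : List α}
    (hl : l ∈ walkLists hG n x) : l.head? = some x := by
  cases n with
  | zero => simp_all [walkLists]
  | succ n =>
    simp only [walkLists, Finset.mem_biUnion, Finset.mem_image] at hl
    obtain ⟨_, -, _, -, rfl⟩ := hl
    rfl

variable (G) in
/-- One step of the simple random walk has probability `(max 1 n_G x)⁻¹`. -/
def invDegree (x : α) : ℝ := (max 1 ((G.neighborSet x).ncard : ℝ))⁻¹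

theorem invDegree_nonneg (x : α) : 0 ≤ invDegree G x := by
  unfold invDegree; positivity

theorem invDegree_le_one (x : α) : invDegree G x ≤ 1 :=
  inv_le_one_of_one_le₀ (le_max_left _ _)

/-- Induction on the first step: the at most `max 1 n_G x` choices are paid for by the factor at
`x`. The factor at the last vertex, not needed for this, is kept so that the weight of a path
involves all `n + 1` vertices of its animal. -/
theorem sum_walkLists_le_one (hG : ∀ x, (G.neighborSet x).Finite) (n : ℕ) (x : α) :
    ∑ l ∈ walkLists hG n x, (l.map (invDegree G)).prod ≤ 1 := by
  classical
  have hnn : ∀ l : List α, 0 ≤ (l.map (invDegree G)).prod := fun l =>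
    List.prod_nonneg fun a ha => by
      obtain ⟨b, -, rfl⟩ := List.mem_map.1 ha
      exact invDegree_nonneg b
  induction n generalizing x with
  | zero => simpa [walkLists] using invDegree_le_one x
  | succ n ih =>
    calc ∑ l ∈ walkLists hG (n + 1) x, (l.map (invDegree G)).prod
        ≤ ∑ y ∈ (hG x).toFinset, ∑ l ∈ (walkLists hG n y).image (List.cons x),
            (l.map (invDegree G)).prod := by
          simp only [walkLists]
          refine (Finset.sum_biUnion fun y _ y' _ hyy' => ?_).le
          refine Finset.disjoint_left.2 fun l hl hl' => hyy' ?_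
          obtain ⟨k, hk, rfl⟩ := Finset.mem_image.1 hl
          obtain ⟨l', hl', he⟩ := Finset.mem_image.1 hl'
          rw [(List.cons.inj he).2] at hl'
          exact Option.some.inj
            ((head?_of_mem_walkLists hG hk).symm.trans (head?_of_mem_walkLists hG hl'))
      _ ≤ ∑ y ∈ (hG x).toFinset, invDegree G x := by
          refine Finset.sum_le_sum fun y _ => ?_
          rw [Finset.sum_image fun a _ b _ h => (List.cons.inj h).2]
          simp only [List.map_cons, List.prod_cons, ← Finset.mul_sum]
          exact mul_le_of_le_one_right (invDegree_nonneg x) (ih y)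
      _ ≤ 1 := by
          rw [Finset.sum_const, nsmul_eq_mul, ← Set.ncard_eq_toFinset_card _ (hG x), invDegree,
            ← div_eq_mul_inv]
          exact div_le_one_of_le₀ (le_max_right _ _) (by positivity)

open Classical in
/-- The vertex lists of the simple paths of length `n` starting at `x`. -/
def pathLists (hG : ∀ x, (G.neighborSet x).Finite) (n : ℕ) (x : α) : Finset (List α) :=
  (walkLists hG n x).filter fun l => ∃ (y : α) (p : G.Walk x y), p.IsPath ∧ p.length = n ∧
    p.support = l

theorem mem_simplePaths_of_isPath {x y : α} (p : G.Walk x y) (hp : p.IsPath) :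
    (⟨y, p⟩ : Σ y, G.Walk x y) ∈ simplePaths G p.length x := by
  classical
  refine ⟨hp, ?_, ?_, ?_, ?_⟩
  · intro z hz
    have hz' : z ∈ p.support := by simpa [pathAnimal] using hz
    refine (p.takeUntil z hz').edist_le.trans ?_
    exact_mod_cast p.length_takeUntil_le_length hz'
  · simp [pathAnimal]
  · rw [pathAnimal, List.toFinset_card_of_nodup hp.support_nodup, p.length_support]
  · have := p.connected_induce_support
    convert this using 2
    all_goals (ext; simp [pathAnimal])

theorem card_pathAnimal {x y : α} (p : G.Walk x y) (hp : p.IsPath) :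
    (pathAnimal G ⟨y, p⟩).card = p.length + 1 := by
  classical
  rw [pathAnimal, List.toFinset_card_of_nodup hp.support_nodup, p.length_support]

/-- If along every simple path of length `n` the weights beat the degrees by a factor `c`, then
the total weight of the simple paths of length `n` is at most `c`. -/
theorem sum_pathLists_le [DecidableEq α] (hG : ∀ x, (G.neighborSet x).Finite) (n : ℕ) (x : α)
    (w : α → ℝ) (c : ℝ)
    (hc : 0 ≤ c)
    (h : ∀ (y : α) (p : G.Walk x y), p.IsPath → p.length = n →
      ∏ z ∈ pathAnimal G ⟨y, p⟩, w z ≤ c * ∏ z ∈ pathAnimal G ⟨y, p⟩, invDegree G z) :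
    ∑ l ∈ pathLists hG n x, ∏ z ∈ l.toFinset, w z ≤ c := by
  classical
  calc ∑ l ∈ pathLists hG n x, ∏ z ∈ l.toFinset, w z
      ≤ ∑ l ∈ pathLists hG n x, c * (l.map (invDegree G)).prod := by
        refine Finset.sum_le_sum fun l hl => ?_
        obtain ⟨-, y, p, hp, hn, rfl⟩ := Finset.mem_filter.1 hl
        rw [← List.prod_toFinset _ hp.support_nodup]
        have hpA : pathAnimal G ⟨y, p⟩ = p.support.toFinset := by ext; simp [pathAnimal]
        simpa only [hpA] using h y p hp hn
    _ ≤ ∑ l ∈ walkLists hG n x, c * (l.map (invDegree G)).prod := by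
        refine Finset.sum_le_sum_of_subset_of_nonneg (Finset.filter_subset _ _) fun l _ _ => ?_
        refine mul_nonneg hc (List.prod_nonneg fun a ha => ?_)
        obtain ⟨b, -, rfl⟩ := List.mem_map.1 ha
        exact invDegree_nonneg b
    _ ≤ c := by
        rw [← Finset.mul_sum]
        exact mul_le_of_le_one_right hc (sum_walkLists_le_one hG n x)

/-- Since `log n ≤ g n`, the product of the degrees is at most the exponential of `∑ g`, which
temperedness controls. An isolated vertex contributes `1`, whence `0 ≤ g 0`. -/
theorem IsTemperedAlong.prod_max_degree_le {g : ℕ → ℝ} {a : ℝ} {N : α → ℕ → ℕ}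
    (h : IsTemperedAlong G g a N) (hg0 : 0 ≤ g 0)
    (hg : ∀ n : ℕ, 1 ≤ n → Real.log n ≤ g n) (x : α) (k : ℕ) {A : Finset α}
    (hA : A ∈ animals G (N x k) x) :
    ∏ z ∈ A, max 1 ((G.neighborSet z).ncard : ℝ) ≤ Real.exp (a * A.card) := by
  have h1 : (degreeAverage G g A : EReal) ≤ a := by
    rw [← h.2.2]
    exact le_iSup_of_le x <| le_iSup_of_le k <| le_iSup₂_of_le A hA le_rfl
  have h2 : degreeAverage G g A ≤ a := by exact_mod_cast h1
  have hpos : 0 < (A.card : ℝ) := by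
    have := hA.2.2.1
    exact_mod_cast (by omega : 0 < A.card)
  rw [degreeAverage, inv_mul_le_iff₀ hpos, mul_comm] at h2
  refine le_trans ?_ (Real.exp_le_exp.2 h2)
  rw [Real.exp_sum]
  refine Finset.prod_le_prod (fun _ _ => by positivity) fun z _ => ?_
  rcases Nat.eq_zero_or_pos (G.neighborSet z).ncard with h0 | h0
  · simpa [h0] using hg0
  · rw [max_eq_right (by exact_mod_cast h0)]
    exact (Real.le_exp_log _).trans (Real.exp_le_exp.2 (hg _ h0))

end TemperedGraph

namespace RandomField

theorem prod_le_exp_of_weightAverage_le {V : Type*} {H : DependenceHypergraph V} {δ : H.Edge → ℝ}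
    {A : Finset H.Edge} (hδ : ∀ e ∈ A, 0 ≤ δ e) (hA : A.Nonempty) {b : ℝ}
    (h : weightAverage δ A ≤ (b : EReal)) :
    ∏ e ∈ A, (Real.exp (2 * δ e) - 1) ≤ Real.exp (b * A.card) := by
  have hnn : ∀ e ∈ A, 0 ≤ Real.exp (2 * δ e) - 1 := fun e he => by
    have := Real.one_le_exp (x := 2 * δ e) (by have := hδ e he; positivity)
    linarith
  -- A zero factor has logarithm `-∞`, so the average is not real; the product is then `0`.
  -- Otherwise all logarithms are finite.
  by_cases h0 : ∃ e ∈ A, Real.exp (2 * δ e) - 1 = 0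
  · obtain ⟨e, he, h0⟩ := h0
    rw [Finset.prod_eq_zero he h0]
    positivity
  push Not at h0
  have hpos : ∀ e ∈ A, 0 < Real.exp (2 * δ e) - 1 := fun e he =>
    lt_of_le_of_ne (hnn e he) (h0 e he).symm
  have hsum : ∑ e ∈ A, ENNReal.log (ENNReal.ofReal (Real.exp (2 * δ e) - 1)) =
      ((∑ e ∈ A, Real.log (Real.exp (2 * δ e) - 1) : ℝ) : EReal) := by
    rw [Finset.sum_congr rfl fun e he => ENNReal.log_ofReal_of_pos (hpos e he)]
    exact (map_sum (⟨⟨Real.toEReal, EReal.coe_zero⟩, EReal.coe_add⟩ : ℝ →+ EReal) _ _).symm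
  rw [weightAverage, hsum, ← EReal.coe_mul, EReal.coe_le_coe_iff] at h
  have hc : 0 < (A.card : ℝ) := by exact_mod_cast hA.card_pos
  rw [inv_mul_le_iff₀ hc, mul_comm] at h
  calc ∏ e ∈ A, (Real.exp (2 * δ e) - 1)
      = Real.exp (∑ e ∈ A, Real.log (Real.exp (2 * δ e) - 1)) := by
        rw [Real.exp_sum]
        exact Finset.prod_congr rfl fun e he => (Real.exp_log (hpos e he)).symm
    _ ≤ _ := Real.exp_le_exp.2 h

end RandomField

/-! ### Subset expansions -/

/-- A union bound for subset expansions: the part of `∏ (1 + F)` carried by the subsets which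
contain one of the sets `s i` is at most `∑ i, ∏_{s i} p` times the whole product. -/
theorem Finset.sum_prod_le_of_exists_subset {ι κ : Type*} [DecidableEq ι] (T : Finset ι)
    (F p : ι → ℝ) (hF : ∀ e, 0 ≤ F e) (hFp : ∀ e, F e ≤ p e) (𝓑 : Finset (Finset ι))
    (h𝓑 : 𝓑 ⊆ T.powerset) (I : Finset κ) (s : κ → Finset ι)
    (hs : ∀ B ∈ 𝓑, ∃ i ∈ I, s i ⊆ B) :
    ∑ B ∈ 𝓑, ∏ e ∈ B, F e ≤ (∑ i ∈ I, ∏ e ∈ s i, p e) * ∏ e ∈ T, (1 + F e) := by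
  have hnn : ∀ B : Finset ι, 0 ≤ ∏ e ∈ B, F e := fun B => Finset.prod_nonneg fun e _ => hF e
  calc ∑ B ∈ 𝓑, ∏ e ∈ B, F e
      ≤ ∑ B ∈ 𝓑, ∑ i ∈ I, if s i ⊆ B then ∏ e ∈ B, F e else 0 := by
        refine Finset.sum_le_sum fun B hB => ?_
        obtain ⟨i, hi, hiB⟩ := hs B hB
        have := Finset.single_le_sum (f := fun i => if s i ⊆ B then ∏ e ∈ B, F e else 0)
          (fun j _ => by split_ifs; exacts [hnn B, le_rfl]) hi
        simpa [hiB] using this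
    _ ≤ ∑ B ∈ T.powerset, ∑ i ∈ I, if s i ⊆ B then ∏ e ∈ B, F e else 0 := by
        refine Finset.sum_le_sum_of_subset_of_nonneg h𝓑 fun B _ _ =>
          Finset.sum_nonneg fun j _ => ?_
        split_ifs; exacts [hnn B, le_rfl]
    _ = ∑ i ∈ I, ∑ B ∈ T.powerset with s i ⊆ B, ∏ e ∈ B, F e := by
        rw [Finset.sum_comm]
        exact Finset.sum_congr rfl fun i _ => (Finset.sum_filter _ _).symm
    _ ≤ ∑ i ∈ I, (∏ e ∈ s i, p e) * ∏ e ∈ T, (1 + F e) := by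
        refine Finset.sum_le_sum fun i _ => ?_
        have hp : ∏ e ∈ s i, F e ≤ ∏ e ∈ s i, p e :=
          Finset.prod_le_prod (fun e _ => hF e) fun e _ => hFp e
        have hT : 0 ≤ ∏ e ∈ T, (1 + F e) := Finset.prod_nonneg fun e _ => by linarith [hF e]
        by_cases hi : s i ⊆ T
        -- The `B` containing `s i` are the unions of `s i` with subsets of `T \ s i`, so the sum
        -- factorizes; passing from `T \ s i` to `T` only multiplies by factors `1 + F ≥ 1`.
        · calc ∑ B ∈ T.powerset with s i ⊆ B, ∏ e ∈ B, F e
              = ∑ B ∈ (T \ s i).powerset, ∏ e ∈ B ∪ s i, F e := by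
                symm
                refine Finset.sum_bij' (fun B _ => B ∪ s i) (fun B _ => B \ s i) ?_ ?_ ?_ ?_ ?_
                · intro B hB
                  simp only [Finset.mem_filter, Finset.mem_powerset] at hB ⊢
                  exact ⟨Finset.union_subset (hB.trans Finset.sdiff_subset) hi,
                    Finset.subset_union_right⟩
                · intro B hB
                  simp only [Finset.mem_filter, Finset.mem_powerset] at hB ⊢
                  exact Finset.sdiff_subset_sdiff hB.1 le_rfl
                · intro B hB
                  simp only [Finset.mem_powerset] at hB
                  ext e
                  have := @hB e
                  simp only [Finset.mem_sdiff, Finset.mem_union] at this ⊢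
                  tauto
                · intro B hB
                  simp only [Finset.mem_filter] at hB
                  exact Finset.sdiff_union_of_subset hB.2
                · intro B hB; rfl
            _ = (∏ e ∈ s i, F e) * ∏ e ∈ T \ s i, (1 + F e) := by
                rw [Finset.prod_one_add, Finset.mul_sum]
                refine Finset.sum_congr rfl fun B hB => ?_
                rw [Finset.prod_union, mul_comm]
                exact Finset.disjoint_of_subset_left (Finset.mem_powerset.1 hB)
                  Finset.sdiff_disjoint
            _ ≤ (∏ e ∈ s i, p e) * ∏ e ∈ T, (1 + F e) := by
                refine mul_le_mul hp ?_ (Finset.prod_nonneg fun e _ => by linarith [hF e])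
                  ((hnn _).trans hp)
                refine Finset.prod_le_prod_of_subset_of_one_le Finset.sdiff_subset
                  (fun e _ => by linarith [hF e]) fun e _ _ => by linarith [hF e]
        · rw [Finset.sum_eq_zero]
          · exact mul_nonneg ((hnn _).trans hp) hT
          · intro B hB
            simp only [Finset.mem_filter, Finset.mem_powerset] at hB
            exact absurd (hB.2.trans hB.1) hi
    _ = _ := (Finset.sum_mul _ _ _).symm

/-! ### Events and functions depending on given coordinates -/

namespace MeasureTheory

variable {V S : Type*} [MeasurableSpace S]

theorem dependsOn_of_measurableSet_cylinderEvents {T : Set V} {A : Set (V → S)}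
    (hA : MeasurableSet[cylinderEvents (X := fun _ : V => S) T] A) {σ τ : V → S}
    (h : ∀ x ∈ T, σ x = τ x) : σ ∈ A ↔ τ ∈ A := by
  have hle : cylinderEvents (X := fun _ : V => S) T ≤
      MeasurableSpace.comap (Set.domRestrict T) MeasurableSpace.pi := by
    refine iSup₂_le fun i hi => ?_
    have : (fun σ : V → S => σ i) = (fun ρ : T → S => ρ ⟨i, hi⟩) ∘ Set.domRestrict T := rfl
    rw [this, ← MeasurableSpace.comap_comp]
    exact MeasurableSpace.comap_mono (measurable_pi_apply _).comap_le
  obtain ⟨B, -, rfl⟩ := hle A hA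
  have : Set.domRestrict T σ = Set.domRestrict T τ := funext fun x => h x x.2
  simp [Set.mem_preimage, this]

theorem dependsOn_of_measurable_cylinderEvents {T : Set V} {f : (V → S) → ℝ}
    (hf : Measurable[cylinderEvents (X := fun _ : V => S) T] f) {σ τ : V → S}
    (h : ∀ x ∈ T, σ x = τ x) : f σ = f τ :=
  ((dependsOn_of_measurableSet_cylinderEvents (hf (measurableSet_singleton (f τ))) h).2 rfl)

/-- Freezing the coordinates off `T` at a fixed configuration is a map measurable with respect to
the events in `T`, and it does not change the value of `f`. -/
theorem measurable_cylinderEvents_of_dependsOn {β : Type*} [MeasurableSpace β] {T : Set V}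
    {f : (V → S) → β} (hf : Measurable f)
    (h : ∀ σ τ : V → S, (∀ x ∈ T, σ x = τ x) → f σ = f τ) :
    Measurable[cylinderEvents (X := fun _ : V => S) T] f := by
  classical
  rcases isEmpty_or_nonempty (V → S) with _ | ⟨⟨s⟩⟩
  · exact fun _ _ => by rw [Set.eq_empty_of_isEmpty (f ⁻¹' _)]
                        exact MeasurableSpace.measurableSet_empty _
  have hr : Measurable[cylinderEvents (X := fun _ : V => S) T]
      (fun (σ : V → S) (x : V) => if x ∈ T then σ x else s x) := by
    rw [@measurable_pi_iff]
    intro x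
    by_cases hx : x ∈ T
    · simpa [hx] using measurable_cylinderEvent_apply (X := fun _ : V => S) hx
    · simp [hx]
  have : f = f ∘ fun (σ : V → S) (x : V) => if x ∈ T then σ x else s x :=
    funext fun σ => h _ _ fun x hx => by simp [hx]
  rw [this]
  exact hf.comp hr

end MeasureTheory

/-! ### Independent resampling and the consistency of the specification -/

namespace RandomField

section Product

variable {ι S : Type*} [Fintype ι] [MeasurableSpace S] (χ : Measure S) [IsProbabilityMeasure χ]

/-- Two independent product samples are one product sample of pairs, so sitewise measure-preserving
maps of pairs may be applied independently. -/
theorem measurePreserving_prodPi {β : Type*} [MeasurableSpace β] {ν : Measure β}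
    [SigmaFinite ν] {k : ι → S × S → β} (hk : ∀ i, MeasurePreserving (k i) (χ.prod χ) ν) :
    MeasurePreserving (fun (p : (ι → S) × (ι → S)) (i : ι) => k i (p.1 i, p.2 i))
      ((Measure.pi fun _ => χ).prod (Measure.pi fun _ => χ)) (Measure.pi fun _ => ν) := by
  have h1 := (measurePreserving_arrowProdEquivProdArrow S S ι (fun _ => χ) (fun _ => χ)).symm
  exact (measurePreserving_pi (fun _ : ι => χ.prod χ) (fun _ => ν) hk).comp h1

open Classical in
theorem measurePreserving_mix (C : Set ι) :
    MeasurePreserving (fun (p : (ι → S) × (ι → S)) (i : ι) => if i ∈ C then p.2 i else p.1 i)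
      ((Measure.pi fun _ => χ).prod (Measure.pi fun _ => χ)) (Measure.pi fun _ => χ) := by
  have := measurePreserving_prodPi χ (ν := χ)
    (k := fun (i : ι) (p : S × S) => if i ∈ C then p.2 else p.1) fun i => by
      by_cases hi : i ∈ C
      · simpa [hi] using measurePreserving_snd
      · simpa [hi] using measurePreserving_fst
  exact this

open Classical in
/-- Exchanging the coordinates in `C` of two independent samples preserves their joint law. -/
theorem measurePreserving_swapOn (C : Set ι) :
    MeasurePreserving (fun p : (ι → S) × (ι → S) =>
        ((fun i => if i ∈ C then p.2 i else p.1 i : ι → S),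
          (fun i => if i ∈ C then p.1 i else p.2 i : ι → S)))
      ((Measure.pi fun _ => χ).prod (Measure.pi fun _ => χ))
      ((Measure.pi fun _ => χ).prod (Measure.pi fun _ => χ)) := by
  have h1 := measurePreserving_prodPi χ (ν := χ.prod χ)
    (k := fun (i : ι) (p : S × S) => if i ∈ C then p.swap else p) fun i => by
      by_cases hi : i ∈ C
      · simpa [hi] using Measure.measurePreserving_swap
      · simpa [hi] using! MeasurePreserving.id _
  have h2 := (measurePreserving_arrowProdEquivProdArrow S S ι (fun _ => χ) (fun _ => χ)).comp h1
  convert h2 using 1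
  funext p
  refine Prod.ext (funext fun i => ?_) (funext fun i => ?_) <;>
    by_cases hi : i ∈ C <;>
    simp [hi, MeasurableEquiv.arrowProdEquivProdArrow, Equiv.arrowProdEquivProdArrow]

end Product

section Glue

variable {V S : Type*}

theorem glue_of_mem {Λ : Finset V} {σ : V → S} {ζ : Λ → S} {x : V} (hx : x ∈ Λ) :
    glue Λ σ ζ x = ζ ⟨x, hx⟩ := by simp [glue, hx]

theorem glue_of_notMem {Λ : Finset V} {σ : V → S} {ζ : Λ → S} {x : V} (hx : x ∉ Λ) :
    glue Λ σ ζ x = σ x := by simp [glue, hx]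

theorem glue_congr {Λ : Finset V} {σ τ : V → S} (h : ∀ x ∉ Λ, σ x = τ x) :
    glue Λ σ = glue Λ τ := by
  funext ζ x
  by_cases hx : x ∈ Λ
  · rw [glue_of_mem hx, glue_of_mem hx]
  · rw [glue_of_notMem hx, glue_of_notMem hx, h x hx]

end Glue

variable {V S : Type*} [MeasurableSpace S]

theorem measurable_glue (Λ : Finset V) :
    Measurable fun p : (V → S) × (Λ → S) => glue Λ p.1 p.2 := by
  refine measurable_pi_lambda _ fun x => ?_
  by_cases hx : x ∈ Λ
  · simp only [glue_of_mem hx]; fun_prop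
  · simp only [glue_of_notMem hx]; fun_prop

theorem measurable_glue_right (Λ : Finset V) (σ : V → S) : Measurable (glue Λ σ) :=
  (measurable_glue Λ).comp measurable_prodMk_left

variable (χ : Measure S)

theorem indepKernel_congr {Λ : Finset V} {σ τ : V → S} (h : ∀ x ∉ Λ, σ x = τ x) :
    indepKernel χ Λ σ = indepKernel χ Λ τ := by
  rw [indepKernel, indepKernel, glue_congr h]

theorem lintegral_indepKernel (Λ : Finset V) (σ : V → S) {f : (V → S) → ℝ≥0∞}
    (hf : Measurable f) :
    ∫⁻ η, f η ∂(indepKernel χ Λ σ) = ∫⁻ ζ, f (glue Λ σ ζ) ∂(Measure.pi fun _ : Λ => χ) :=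
  lintegral_map hf (measurable_glue_right Λ σ)

variable {H : DependenceHypergraph V} {h : H.Edge → (V → S) → ℝ} {m M : H.Edge → ℝ}

theorem mem_touching {Λ : Finset V} {e : H.Edge} :
    e ∈ H.touching Λ ↔ ∃ x ∈ Λ, x ∈ (e : Set V) := by
  simp only [DependenceHypergraph.touching, Set.Finite.mem_toFinset, Set.mem_ofPred_eq,
    Set.Nonempty, Set.mem_inter_iff, Finset.mem_coe]
  exact exists_congr fun _ => and_comm

variable {Λ Λ' : Finset V} {σ τ : V → S} {f : (V → S) → ℝ≥0∞}

/-- `h_Λ` as an extended nonnegative function. -/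
def weight (H : DependenceHypergraph V) (h : H.Edge → (V → S) → ℝ) (Λ : Finset V) (σ : V → S) :
    ℝ≥0∞ :=
  ENNReal.ofReal (preModification H h Λ σ)

/-- The normalization `χ_Λ(h_Λ)`. -/
def partition (H : DependenceHypergraph V) (h : H.Edge → (V → S) → ℝ) (Λ : Finset V)
    (σ : V → S) : ℝ≥0∞ :=
  ∫⁻ η, weight H h Λ η ∂(indepKernel χ Λ σ)

theorem partition_congr (hστ : ∀ x ∉ Λ, σ x = τ x) :
    partition χ H h Λ σ = partition χ H h Λ τ := by
  rw [partition, partition, indepKernel_congr χ hστ]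

theorem specification_congr (hστ : ∀ x ∉ Λ, σ x = τ x) :
    specification χ H h Λ σ = specification χ H h Λ τ := by
  rw [specification, specification, indepKernel_congr χ hστ]

variable [IsProbabilityMeasure χ]

instance (Λ : Finset V) (σ : V → S) : IsProbabilityMeasure (indepKernel χ Λ σ) :=
  Measure.isProbabilityMeasure_map (measurable_glue_right Λ σ).aemeasurable

theorem measurable_lintegral_indepKernel (Λ : Finset V) {f : (V → S) → ℝ≥0∞}
    (hf : Measurable f) : Measurable fun σ => ∫⁻ η, f η ∂(indepKernel χ Λ σ) := by
  simp_rw [lintegral_indepKernel χ Λ _ hf]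
  exact (hf.comp (measurable_glue Λ)).lintegral_prod_right'

/-- Resampling `Λ ⊆ Λ'` after having sampled `Λ'` has no effect. -/
theorem lintegral_lintegral_indepKernel {Λ Λ' : Finset V} (hΛ : Λ ⊆ Λ') (σ : V → S)
    {f : (V → S) → ℝ≥0∞} (hf : Measurable f) :
    ∫⁻ η, ∫⁻ τ, f τ ∂(indepKernel χ Λ η) ∂(indepKernel χ Λ' σ) =
      ∫⁻ τ, f τ ∂(indepKernel χ Λ' σ) := by
  classical
  -- The new sample in `Λ` is taken as the marginal of a second sample in `Λ'`; resampling then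
  -- becomes mixing two samples in `Λ'`.
  have hproj : (Measure.pi fun _ : Λ => χ) =
      (Measure.pi fun _ : Λ' => χ).map (Finset.restrict₂ (π := fun _ => S) hΛ) :=
    isProjectiveMeasureFamily_pi (fun _ : V => χ) Λ' Λ hΛ
  have hmix := measurePreserving_mix χ {x : Λ' | (x : V) ∈ Λ}
  rw [lintegral_indepKernel χ _ _ (measurable_lintegral_indepKernel χ Λ hf),
    lintegral_indepKernel χ _ _ hf]
  have hmeas : Measurable fun ζ' => f (glue Λ' σ ζ') := hf.comp (measurable_glue_right Λ' σ)
  rw [← hmix.lintegral_comp hmeas, lintegral_prod]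
  swap
  · exact (hmeas.comp hmix.measurable).aemeasurable
  refine lintegral_congr fun ζ' => ?_
  have hfΛ : Measurable fun ζ => f (glue Λ (glue Λ' σ ζ') ζ) :=
    hf.comp (measurable_glue_right Λ _)
  rw [lintegral_indepKernel χ _ _ hf, hproj,
    lintegral_map hfΛ (Finset.measurable_restrict₂ hΛ)]
  refine lintegral_congr fun ζ => ?_
  congr 1
  funext x
  by_cases hx : x ∈ Λ
  · rw [glue_of_mem hx, glue_of_mem (hΛ hx)]
    simp [hx]
  · rw [glue_of_notMem hx]
    by_cases hx' : x ∈ Λ'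
    · rw [glue_of_mem hx', glue_of_mem hx']
      simp [hx]
    · rw [glue_of_notMem hx', glue_of_notMem hx']

namespace IsBoundedFamily

section

variable (hh : IsBoundedFamily H h m M)
include hh

theorem measurable_edge (e : H.Edge) : Measurable (h e) :=
  (hh.measurable e).mono cylinderEvents_le_pi le_rfl

theorem pos (e : H.Edge) (σ : V → S) : 0 < h e σ := (hh.lower_pos e).trans_le (hh.lower_le e σ)

theorem edge_congr {e : H.Edge} (hστ : ∀ x ∈ (e : Set V), σ x = τ x) : h e σ = h e τ :=
  dependsOn_of_measurable_cylinderEvents (hh.measurable e) hστ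

theorem measurable_preModification (Λ : Finset V) : Measurable (preModification H h Λ) :=
  Finset.measurable_prod _ fun e _ => hh.measurable_edge e

theorem preModification_pos (Λ : Finset V) (σ : V → S) : 0 < preModification H h Λ σ :=
  Finset.prod_pos fun e _ => hh.pos e σ

theorem preModification_le (Λ : Finset V) (σ : V → S) :
    preModification H h Λ σ ≤ ∏ e ∈ H.touching Λ, M e :=
  Finset.prod_le_prod (fun e _ => (hh.pos e σ).le) fun e _ => hh.le_upper e σ

theorem le_preModification (Λ : Finset V) (σ : V → S) :
    ∏ e ∈ H.touching Λ, m e ≤ preModification H h Λ σ :=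
  Finset.prod_le_prod (fun e _ => (hh.lower_pos e).le) fun e _ => hh.lower_le e σ

theorem measurable_weight (Λ : Finset V) : Measurable (weight H h Λ) :=
  (hh.measurable_preModification Λ).ennreal_ofReal

theorem measurable_partition (Λ : Finset V) : Measurable (partition χ H h Λ) :=
  measurable_lintegral_indepKernel χ Λ (hh.measurable_weight Λ)

theorem partition_ne_zero (Λ : Finset V) (σ : V → S) : partition χ H h Λ σ ≠ 0 := by
  have h1 : ENNReal.ofReal (∏ e ∈ H.touching Λ, m e) ≤ partition χ H h Λ σ := by
    calc _ = ∫⁻ _, ENNReal.ofReal (∏ e ∈ H.touching Λ, m e) ∂(indepKernel χ Λ σ) := by simp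
      _ ≤ _ := lintegral_mono fun η => ENNReal.ofReal_le_ofReal (hh.le_preModification Λ η)
  refine (lt_of_lt_of_le ?_ h1).ne'
  exact ENNReal.ofReal_pos.2 (Finset.prod_pos fun e _ => hh.lower_pos e)

theorem partition_ne_top (Λ : Finset V) (σ : V → S) : partition χ H h Λ σ ≠ ⊤ := by
  have h1 : partition χ H h Λ σ ≤ ENNReal.ofReal (∏ e ∈ H.touching Λ, M e) := by
    calc _ ≤ ∫⁻ _, ENNReal.ofReal (∏ e ∈ H.touching Λ, M e) ∂(indepKernel χ Λ σ) :=
          lintegral_mono fun η => ENNReal.ofReal_le_ofReal (hh.preModification_le Λ η)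
      _ = _ := by simp
  exact ne_top_of_le_ne_top ENNReal.ofReal_ne_top h1

/-- The bridge to lower integrals: the bounds `m`, `M` make the normalization positive and finite,
so the real quotient and the extended one agree. -/
theorem ofReal_modification (Λ : Finset V) (σ : V → S) :
    ENNReal.ofReal (modification χ H h Λ σ) = weight H h Λ σ / partition χ H h Λ σ := by
  have hZ : ∫ η, preModification H h Λ η ∂(indepKernel χ Λ σ) = (partition χ H h Λ σ).toReal := by
    rw [integral_eq_lintegral_of_nonneg_ae (.of_forall fun η => (hh.preModification_pos Λ η).le)
      (hh.measurable_preModification Λ).aestronglyMeasurable]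
    rfl
  have hpos : 0 < (partition χ H h Λ σ).toReal :=
    ENNReal.toReal_pos (hh.partition_ne_zero χ Λ σ) (hh.partition_ne_top χ Λ σ)
  rw [modification, hZ, ENNReal.ofReal_div_of_pos hpos,
    ENNReal.ofReal_toReal (hh.partition_ne_top χ Λ σ), weight]

theorem lintegral_specification (Λ : Finset V) (σ : V → S) (hf : Measurable f) :
    ∫⁻ η, f η ∂(specification χ H h Λ σ) =
      (∫⁻ η, weight H h Λ η * f η ∂(indepKernel χ Λ σ)) / partition χ H h Λ σ := by
  have hw := hh.measurable_weight Λ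
  have hZ := hh.measurable_partition χ Λ
  rw [specification]
  simp_rw [hh.ofReal_modification χ]
  have hwZ : Measurable fun η => weight H h Λ η / partition χ H h Λ η := hw.div hZ
  have hwf : Measurable fun η => weight H h Λ η * f η := hw.mul hf
  have hgwf : Measurable fun ζ : Λ → S => weight H h Λ (glue Λ σ ζ) * f (glue Λ σ ζ) :=
    hwf.comp (measurable_glue_right Λ σ)
  rw [lintegral_withDensity_eq_lintegral_mul _ hwZ hf]
  rw [lintegral_indepKernel χ _ _ (hwZ.mul hf), lintegral_indepKernel χ _ _ hwf,
    div_eq_mul_inv, ← lintegral_mul_const _ hgwf]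
  refine lintegral_congr fun ζ => ?_
  simp only [Pi.mul_apply]
  -- The normalization does not depend on the sites in `Λ`, so it is constant on the support of
  -- `χ_Λ(·|σ)`.
  rw [partition_congr χ (fun x hx => glue_of_notMem hx), div_eq_mul_inv]
  ring

theorem isProbabilityMeasure_specification (Λ : Finset V) (σ : V → S) :
    IsProbabilityMeasure (specification χ H h Λ σ) := by
  constructor
  rw [← lintegral_one, hh.lintegral_specification χ Λ σ measurable_const]
  simp only [mul_one]
  exact ENNReal.div_self (hh.partition_ne_zero χ Λ σ) (hh.partition_ne_top χ Λ σ)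

theorem measurable_lintegral_specification (Λ : Finset V) (hf : Measurable f) :
    Measurable fun σ => ∫⁻ η, f η ∂(specification χ H h Λ σ) := by
  simp_rw [hh.lintegral_specification χ Λ _ hf]
  exact (measurable_lintegral_indepKernel χ Λ ((hh.measurable_weight Λ).mul hf)).div
    (hh.measurable_partition χ Λ)

theorem measurable_specification_apply (Λ : Finset V) {A : Set (V → S)} (hA : MeasurableSet A) :
    Measurable fun σ => specification χ H h Λ σ A := by
  simpa [lintegral_indicator_one hA] using
    hh.measurable_lintegral_specification χ Λ (measurable_one.indicator hA)

theorem measurable_specification (Λ : Finset V) : Measurable (specification χ H h Λ) :=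
  Measure.measurable_of_measurable_coe _ fun _ hA => hh.measurable_specification_apply χ Λ hA

/-- The kernels `γ_Λ` are proper: the configuration off `Λ` is left unchanged. -/
theorem lintegral_specification_mul (Λ : Finset V) (σ : V → S) (hf : Measurable f)
    {g : (V → S) → ℝ≥0∞} (hg : Measurable g)
    (hgΛ : ∀ σ τ : V → S, (∀ x ∉ Λ, σ x = τ x) → g σ = g τ) :
    ∫⁻ η, f η * g η ∂(specification χ H h Λ σ) =
      (∫⁻ η, f η ∂(specification χ H h Λ σ)) * g σ := by
  have hw := hh.measurable_weight Λ
  have hfg : Measurable fun η => f η * g η := hf.mul hg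
  have hwf : Measurable fun η => weight H h Λ η * f η := hw.mul hf
  have hwfg : Measurable fun η => weight H h Λ η * (f η * g η) := hw.mul hfg
  rw [hh.lintegral_specification χ Λ σ hf, hh.lintegral_specification χ Λ σ hfg,
    lintegral_indepKernel χ _ _ hwf, lintegral_indepKernel χ _ _ hwfg]
  have : ∀ ζ : Λ → S, g (glue Λ σ ζ) = g σ := fun ζ => hgΛ _ _ fun x hx => glue_of_notMem hx
  simp_rw [this, ← mul_assoc]
  have hgwf : Measurable fun ζ : Λ → S => weight H h Λ (glue Λ σ ζ) * f (glue Λ σ ζ) :=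
    hwf.comp (measurable_glue_right Λ σ)
  rw [lintegral_mul_const _ hgwf, div_eq_mul_inv,
    div_eq_mul_inv, mul_right_comm]

/-- Consistency: `γ_Λ' γ_Λ = γ_Λ'` for `Λ ⊆ Λ'`. -/
theorem lintegral_lintegral_specification (hΛ : Λ ⊆ Λ') (σ : V → S) (hf : Measurable f) :
    ∫⁻ η, ∫⁻ τ, f τ ∂(specification χ H h Λ η) ∂(specification χ H h Λ' σ) =
      ∫⁻ τ, f τ ∂(specification χ H h Λ' σ) := by
  classical
  have hw := hh.measurable_weight Λ
  have hw' := hh.measurable_weight Λ'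
  have hγf := hh.measurable_lintegral_specification χ Λ hf
  have hwf : Measurable fun η => weight H h Λ η * f η := hw.mul hf
  have hwf' : Measurable fun η => weight H h Λ' η * f η := hw'.mul hf
  have hwγf' : Measurable fun η =>
      weight H h Λ' η * ∫⁻ τ, f τ ∂(specification χ H h Λ η) := hw'.mul hγf
  have hsub : H.touching Λ ⊆ H.touching Λ' := fun e he => by
    obtain ⟨x, hx, hxe⟩ := mem_touching.1 he
    exact mem_touching.2 ⟨x, hΛ hx, hxe⟩
  -- The factors of `h_Λ'` whose hyperedges avoid `Λ`: `h_Λ' = h_Λ g`, and `g` is insensitive to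
  -- resampling in `Λ`.
  set g : (V → S) → ℝ≥0∞ := fun σ => ENNReal.ofReal (∏ e ∈ H.touching Λ' \ H.touching Λ, h e σ)
    with hg_def
  have hg : Measurable g :=
    (Finset.measurable_prod _ fun e _ => hh.measurable_edge e).ennreal_ofReal
  have hgΛ : ∀ (η : V → S) (ζ : Λ → S), g (glue Λ η ζ) = g η := fun η ζ => by
    simp only [hg_def]
    congr 1
    refine Finset.prod_congr rfl fun e he => hh.edge_congr fun x hx => glue_of_notMem fun hxΛ => ?_
    exact (Finset.mem_sdiff.1 he).2 (mem_touching.2 ⟨x, hxΛ, hx⟩)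
  have hwg : ∀ η, weight H h Λ' η = weight H h Λ η * g η := fun η => by
    rw [weight, weight, hg_def, ← ENNReal.ofReal_mul (hh.preModification_pos Λ η).le, mul_comm,
      preModification, preModification, Finset.prod_sdiff hsub]
  rw [hh.lintegral_specification χ Λ' σ hγf, hh.lintegral_specification χ Λ' σ hf]
  congr 1
  -- With a resampling in `Λ` inserted on both sides, it suffices to compare under `χ_Λ(·|η)`, where
  -- `g` and `γ_Λ f` are constants.
  rw [← lintegral_lintegral_indepKernel χ hΛ σ hwγf',
    ← lintegral_lintegral_indepKernel χ hΛ σ hwf']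
  refine lintegral_congr fun η => ?_
  rw [lintegral_indepKernel χ _ _ hwγf', lintegral_indepKernel χ _ _ hwf']
  simp_rw [hwg, hgΛ]
  have h1 : ∀ ζ : Λ → S, specification χ H h Λ (glue Λ η ζ) = specification χ H h Λ η := fun ζ =>
    specification_congr χ fun x hx => glue_of_notMem hx
  simp_rw [h1]
  have e1 : ∀ ζ : Λ → S, weight H h Λ (glue Λ η ζ) * g η * ∫⁻ τ, f τ ∂(specification χ H h Λ η) =
      (g η * ∫⁻ τ, f τ ∂(specification χ H h Λ η)) * weight H h Λ (glue Λ η ζ) := fun ζ => by ring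
  have e2 : ∀ ζ : Λ → S, weight H h Λ (glue Λ η ζ) * g η * f (glue Λ η ζ) =
      g η * (weight H h Λ (glue Λ η ζ) * f (glue Λ η ζ)) := fun ζ => by ring
  simp_rw [e1, e2]
  have hgw : Measurable fun ζ : Λ → S => weight H h Λ (glue Λ η ζ) :=
    hw.comp (measurable_glue_right Λ η)
  have hgwf : Measurable fun ζ : Λ → S => weight H h Λ (glue Λ η ζ) * f (glue Λ η ζ) :=
    hwf.comp (measurable_glue_right Λ η)
  rw [lintegral_const_mul _ hgw, lintegral_const_mul _ hgwf,
    ← lintegral_indepKernel χ _ _ hw, ← lintegral_indepKernel χ _ _ hwf,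
    hh.lintegral_specification χ Λ η hf, mul_assoc]
  congr 1
  exact ENNReal.div_mul_cancel (hh.partition_ne_zero χ Λ η) (hh.partition_ne_top χ Λ η)

end

end IsBoundedFamily

end RandomField

/-! ### The two-replica comparison of boundary conditions -/

namespace RandomField

theorem integrable_of_measurable_bounded {β : Type*} [MeasurableSpace β] (μ : Measure β)
    [IsFiniteMeasure μ] {f : β → ℝ} (hf : Measurable f) (c : ℝ) (hc : ∀ x, |f x| ≤ c) :
    Integrable f μ :=
  Integrable.of_bound hf.aestronglyMeasurable c (.of_forall hc)

section Swap

variable {V S : Type*}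

open Classical in
/-- Exchange the coordinates in `C` of a pair of configurations. -/
def pairSwap (C : Set V) (q : (V → S) × (V → S)) : (V → S) × (V → S) :=
  (fun x => if x ∈ C then q.2 x else q.1 x, fun x => if x ∈ C then q.1 x else q.2 x)

theorem pairSwap_fst_of_subset {C T : Set V} (hT : T ⊆ C) (q : (V → S) × (V → S)) :
    ∀ x ∈ T, (pairSwap C q).1 x = q.2 x := fun x hx => by simp [pairSwap, hT hx]

theorem pairSwap_snd_of_subset {C T : Set V} (hT : T ⊆ C) (q : (V → S) × (V → S)) :
    ∀ x ∈ T, (pairSwap C q).2 x = q.1 x := fun x hx => by simp [pairSwap, hT hx]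

theorem pairSwap_fst_of_disjoint {C T : Set V} (hT : Disjoint T C) (q : (V → S) × (V → S)) :
    ∀ x ∈ T, (pairSwap C q).1 x = q.1 x := fun x hx => by
  simp [pairSwap, Set.disjoint_left.1 hT hx]

theorem pairSwap_snd_of_disjoint {C T : Set V} (hT : Disjoint T C) (q : (V → S) × (V → S)) :
    ∀ x ∈ T, (pairSwap C q).2 x = q.2 x := fun x hx => by
  simp [pairSwap, Set.disjoint_left.1 hT hx]

theorem measurable_pairSwap [MeasurableSpace S] (C : Set V) :
    Measurable (pairSwap (S := S) C) := by
  refine Measurable.prodMk ?_ ?_ <;>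
  · refine measurable_pi_lambda _ fun x => ?_
    by_cases hx : x ∈ C <;> simp only [hx, if_true, if_false] <;> fun_prop

end Swap

variable {V S : Type*} [MeasurableSpace S] (χ : Measure S) [IsProbabilityMeasure χ]

/-- The joint law of independent resamplings in `Λ` is invariant under exchanging coordinates in
a set on which the two boundary conditions agree. -/
theorem measurePreserving_pairSwap {Λ : Finset V} {ξ η : V → S} {C : Set V}
    (hC : ∀ x ∈ C, x ∉ Λ → ξ x = η x) :
    MeasurePreserving (pairSwap C) ((indepKernel χ Λ ξ).prod (indepKernel χ Λ η))
      ((indepKernel χ Λ ξ).prod (indepKernel χ Λ η)) := by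
  classical
  refine ⟨measurable_pairSwap C, ?_⟩
  have hs := measurePreserving_swapOn χ {x : Λ | (x : V) ∈ C}
  have hG : Measurable (Prod.map (glue Λ ξ) (glue Λ η)) :=
    (measurable_glue_right Λ ξ).prodMap (measurable_glue_right Λ η)
  have hprod : (indepKernel χ Λ ξ).prod (indepKernel χ Λ η) =
      ((Measure.pi fun _ : Λ => χ).prod (Measure.pi fun _ : Λ => χ)).map
        (Prod.map (glue Λ ξ) (glue Λ η)) :=
    Measure.map_prod_map _ _ (measurable_glue_right Λ ξ) (measurable_glue_right Λ η)
  rw [hprod]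
  nth_rw 2 [← hs.map_eq]
  rw [Measure.map_map (measurable_pairSwap C) hG, Measure.map_map hG hs.measurable]
  congr 1
  funext p
  refine Prod.ext (funext fun x => ?_) (funext fun x => ?_) <;>
  · by_cases hx : x ∈ Λ
    · simp [pairSwap, glue_of_mem hx]
    · by_cases hxC : x ∈ C
      · simp [pairSwap, glue_of_notMem hx, hC x hxC hx]
      · simp [pairSwap, glue_of_notMem hx, hxC]

variable {H : DependenceHypergraph V} {h : H.Edge → (V → S) → ℝ} {m M : H.Edge → ℝ}

/-- The normalized two-replica interaction `h_e(σ) h_e(σ') / m_e ^ 2` in excess of `1`. -/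
def pairExcess {H : DependenceHypergraph V} (h : H.Edge → (V → S) → ℝ) (m : H.Edge → ℝ)
    (e : H.Edge) (q : (V → S) × (V → S)) : ℝ :=
  h e q.1 * h e q.2 / m e ^ 2 - 1

namespace IsBoundedFamily

section
variable (hh : IsBoundedFamily H h m M)
include hh

theorem pairExcess_nonneg (e : H.Edge) (q : (V → S) × (V → S)) : 0 ≤ pairExcess h m e q := by
  have hm := hh.lower_pos e
  rw [pairExcess, sub_nonneg, one_le_div (by positivity), sq]
  exact mul_le_mul (hh.lower_le e _) (hh.lower_le e _) hm.le (hh.pos e _).le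

/-- That `m e ≤ M e` is known only through a value of `h e`, hence the need for a configuration. -/
theorem oscillation_nonneg [Nonempty (V → S)] (e : H.Edge) : 0 ≤ oscillation m M e := by
  obtain ⟨σ⟩ := ‹Nonempty (V → S)›
  exact sub_nonneg.2 (Real.log_le_log (hh.lower_pos e)
    ((hh.lower_le e σ).trans (hh.le_upper e σ)))

theorem pairExcess_le (e : H.Edge) (q : (V → S) × (V → S)) :
    pairExcess h m e q ≤ Real.exp (2 * oscillation m M e) - 1 := by
  have hm := hh.lower_pos e
  have hM : 0 < M e := (hh.pos e q.1).trans_le (hh.le_upper e q.1)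
  have : Real.exp (2 * oscillation m M e) = M e * M e / m e ^ 2 := by
    rw [oscillation, two_mul, Real.exp_add, Real.exp_sub, Real.exp_log hm, Real.exp_log hM]
    field_simp
  rw [this, pairExcess]
  gcongr
  exacts [(hh.pos e _).le, hh.le_upper e _, hh.le_upper e _]

theorem measurable_pairExcess (e : H.Edge) : Measurable (pairExcess h m e) := by
  have h1 : Measurable fun q : (V → S) × (V → S) => h e q.1 :=
    (hh.measurable_edge e).comp measurable_fst
  have h2 : Measurable fun q : (V → S) × (V → S) => h e q.2 :=
    (hh.measurable_edge e).comp measurable_snd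
  exact ((h1.mul h2).div_const _).sub_const _

/-- A hyperedge inside `C` has its two symmetric factors exchanged, one disjoint from `C` sees
nothing. A hyperedge straddling `C` would mix the replicas. -/
theorem pairExcess_pairSwap {e : H.Edge} {C : Set V}
    (he : (e : Set V) ⊆ C ∨ Disjoint (e : Set V) C) (q : (V → S) × (V → S)) :
    pairExcess h m e (pairSwap C q) = pairExcess h m e q := by
  rw [pairExcess, pairExcess]
  rcases he with he | he
  · rw [hh.edge_congr (pairSwap_fst_of_subset he q), hh.edge_congr (pairSwap_snd_of_subset he q),
      mul_comm]
  · rw [hh.edge_congr (pairSwap_fst_of_disjoint he q),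
      hh.edge_congr (pairSwap_snd_of_disjoint he q)]

theorem preModification_mul_preModification (Λ : Finset V) (q : (V → S) × (V → S)) :
    preModification H h Λ q.1 * preModification H h Λ q.2 =
      (∏ e ∈ H.touching Λ, m e ^ 2) * ∏ e ∈ H.touching Λ, (1 + pairExcess h m e q) := by
  rw [preModification, preModification, ← Finset.prod_mul_distrib, ← Finset.prod_mul_distrib]
  refine Finset.prod_congr rfl fun e _ => ?_
  have := (hh.lower_pos e).ne'
  rw [pairExcess]
  field_simp
  ring

theorem specification_real (Λ : Finset V) (σ : V → S) {A : Set (V → S)} (hA : MeasurableSet A) :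
    (specification χ H h Λ σ).real A =
      (∫ η, A.indicator 1 η * preModification H h Λ η ∂(indepKernel χ Λ σ)) /
        ∫ η, preModification H h Λ η ∂(indepKernel χ Λ σ) := by
  have hm := hh.measurable_preModification Λ
  have hA1 : Measurable (A.indicator (1 : (V → S) → ℝ)) := measurable_one.indicator hA
  have hA0 : ∀ η, 0 ≤ A.indicator (1 : (V → S) → ℝ) η := fun η =>
    Set.indicator_nonneg (fun _ _ => zero_le_one) η
  rw [integral_eq_lintegral_of_nonneg_ae (.of_forall fun η => (hh.preModification_pos Λ η).le)
      hm.aestronglyMeasurable,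
    integral_eq_lintegral_of_nonneg_ae
      (.of_forall fun η => mul_nonneg (hA0 η) (hh.preModification_pos Λ η).le)
      (hA1.mul hm).aestronglyMeasurable,
    ← ENNReal.toReal_div, Measure.real, ← lintegral_indicator_one hA,
    hh.lintegral_specification χ Λ σ (measurable_one.indicator hA)]
  congr 2
  refine lintegral_congr fun η => ?_
  by_cases hη : η ∈ A <;> simp [hη, weight]

end

open Classical in
/-- Comparison of two boundary conditions: if every set of hyperedges containing none of the sets
`s i` admits a set of vertices, compatible with its hyperedges, which separates `Δ` from the
disagreement of the boundary conditions, then the events observable in `Δ` have nearly the same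
probability. -/
theorem abs_specification_sub_le (hh : IsBoundedFamily H h m M) {Λ : Finset V} {ξ η : V → S}
    {Δ : Set V} {A : Set (V → S)} (hA : MeasurableSet[cylinderEvents (X := fun _ : V => S) Δ] A)
    {κ : Type*} (I : Finset κ) (s : κ → Finset H.Edge)
    (hsep : ∀ B ⊆ H.touching Λ, (∀ i ∈ I, ¬ s i ⊆ B) → ∃ C : Set V, Δ ⊆ C ∧
      (∀ x ∈ C, x ∉ Λ → ξ x = η x) ∧
        ∀ e ∈ B, (e : Set V) ⊆ C ∨ Disjoint (e : Set V) C) :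
    |(specification χ H h Λ ξ).real A - (specification χ H h Λ η).real A| ≤
      ∑ i ∈ I, ∏ e ∈ s i, (Real.exp (2 * oscillation m M e) - 1) := by
  set T := H.touching Λ
  set p : H.Edge → ℝ := fun e => Real.exp (2 * oscillation m M e) - 1
  have hA' : MeasurableSet A := cylinderEvents_le_pi _ hA
  set ν := indepKernel χ Λ ξ
  set ν' := indepKernel χ Λ η
  set P := ν.prod ν'
  set w := preModification H h Λ
  set o : (V → S) → ℝ := A.indicator 1 with ho
  have ho_meas : Measurable o := measurable_one.indicator hA'
  have ho0 : ∀ σ, 0 ≤ o σ := Set.indicator_nonneg (fun _ _ => zero_le_one)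
  have ho1 : ∀ σ, o σ ≤ 1 := fun σ => Set.indicator_le_self' (f := 1) (fun _ _ => zero_le_one) σ
  have ho_congr : ∀ σ τ : V → S, (∀ x ∈ Δ, σ x = τ x) → o σ = o τ := fun σ τ hστ => by
    have := dependsOn_of_measurableSet_cylinderEvents hA hστ
    by_cases hσ : σ ∈ A
    · simp [ho, hσ, this.1 hσ]
    · simp [ho, hσ, mt this.2 hσ]
  set J : (V → S) × (V → S) → ℝ := fun q => o q.1 - o q.2 with hJ
  have hJ_meas : Measurable J :=
    (ho_meas.comp measurable_fst).sub (ho_meas.comp measurable_snd)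
  have hJ1 : ∀ q, |J q| ≤ 1 := fun q => by
    rw [abs_le]; constructor <;> simp only [hJ] <;>
      linarith [ho0 q.1, ho0 q.2, ho1 q.1, ho1 q.2]
  set K : Finset H.Edge → (V → S) × (V → S) → ℝ := fun B q => ∏ e ∈ B, pairExcess h m e q
  have hK_meas : ∀ B, Measurable (K B) := fun B =>
    Finset.measurable_prod _ fun e _ => hh.measurable_pairExcess e
  have hK0 : ∀ B q, 0 ≤ K B q := fun B q => Finset.prod_nonneg fun e _ => hh.pairExcess_nonneg e q
  have hK1 : ∀ B q, K B q ≤ ∏ e ∈ B, p e := fun B q =>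
    Finset.prod_le_prod (fun e _ => hh.pairExcess_nonneg e q) fun e _ => hh.pairExcess_le e q
  have hK_int : ∀ B, Integrable (K B) P := fun B =>
    integrable_of_measurable_bounded P (hK_meas B) (∏ e ∈ B, p e) fun q => by
      rw [abs_of_nonneg (hK0 B q)]; exact hK1 B q
  have hJK_int : ∀ B, Integrable (fun q => J q * K B q) P := fun B =>
    integrable_of_measurable_bounded P (hJ_meas.mul (hK_meas B)) (∏ e ∈ B, p e) fun q => by
      rw [abs_mul, abs_of_nonneg (hK0 B q)]
      exact (mul_le_of_le_one_left (hK0 B q) (hJ1 q)).trans (hK1 B q)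
  set W : (V → S) × (V → S) → ℝ := fun q => ∏ e ∈ T, (1 + pairExcess h m e q)
  have hW_exp : ∀ q, W q = ∑ B ∈ T.powerset, K B q := fun q => Finset.prod_one_add T
  have hW_int : Integrable W P := by
    rw [show W = fun q => ∑ B ∈ T.powerset, K B q from funext hW_exp]
    exact integrable_finsetSum _ fun B _ => hK_int B
  have hW1 : ∀ q, 1 ≤ W q := fun q => Finset.one_le_prod fun e _ => by
    linarith [hh.pairExcess_nonneg e q]
  have hWpos : 0 < ∫ q, W q ∂P :=
    lt_of_lt_of_le one_pos (by simpa using integral_mono (integrable_const (1 : ℝ)) hW_int hW1)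
  -- the difference as a two-replica expectation
  have hcpos : 0 < ∏ e ∈ T, m e ^ 2 := Finset.prod_pos fun e _ => pow_pos (hh.lower_pos e) 2
  have hden : (∫ σ, w σ ∂ν) * ∫ σ, w σ ∂ν' = (∏ e ∈ T, m e ^ 2) * ∫ q, W q ∂P := by
    rw [← integral_prod_mul, ← integral_const_mul]
    exact integral_congr_ae (.of_forall fun q => hh.preModification_mul_preModification Λ q)
  have hw_meas := hh.measurable_preModification Λ
  have hw_int : ∀ ρ : Measure (V → S), [IsFiniteMeasure ρ] → Integrable w ρ := fun ρ _ =>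
    integrable_of_measurable_bounded ρ hw_meas (∏ e ∈ T, M e) fun σ => by
      rw [abs_of_pos (hh.preModification_pos Λ σ)]; exact hh.preModification_le Λ σ
  have how_int : ∀ ρ : Measure (V → S), [IsFiniteMeasure ρ] →
      Integrable (fun σ => o σ * w σ) ρ := fun ρ _ =>
    integrable_of_measurable_bounded ρ (ho_meas.mul hw_meas) (∏ e ∈ T, M e) fun σ => by
      rw [abs_of_nonneg (mul_nonneg (ho0 σ) (hh.preModification_pos Λ σ).le)]
      exact (mul_le_of_le_one_left (hh.preModification_pos Λ σ).le (ho1 σ)).trans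
        (hh.preModification_le Λ σ)
  have hnum : (∫ σ, o σ * w σ ∂ν) * (∫ σ, w σ ∂ν') - (∫ σ, w σ ∂ν) * (∫ σ, o σ * w σ ∂ν') =
      (∏ e ∈ T, m e ^ 2) * ∫ q, J q * W q ∂P := by
    rw [← integral_prod_mul, ← integral_prod_mul, ← integral_const_mul,
      ← integral_sub ((how_int ν).mul_prod (hw_int ν')) ((hw_int ν).mul_prod (how_int ν'))]
    refine integral_congr_ae (.of_forall fun q => ?_)
    have := hh.preModification_mul_preModification Λ q
    simp only [hJ]
    linear_combination (o q.1 - o q.2) * this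
  have hw_pos : ∀ ρ : Measure (V → S), [IsProbabilityMeasure ρ] → 0 < ∫ σ, w σ ∂ρ := fun ρ _ =>
    calc (0 : ℝ) < ∏ e ∈ T, m e := Finset.prod_pos fun e _ => hh.lower_pos e
      _ = ∫ _, ∏ e ∈ T, m e ∂ρ := by simp
      _ ≤ ∫ σ, w σ ∂ρ := integral_mono (integrable_const _) (hw_int ρ) (hh.le_preModification Λ)
  have hdiff : (specification χ H h Λ ξ).real A - (specification χ H h Λ η).real A =
      (∫ q, J q * W q ∂P) / ∫ q, W q ∂P := by
    rw [hh.specification_real χ Λ ξ hA', hh.specification_real χ Λ η hA',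
      div_sub_div _ _ (hw_pos ν).ne' (hw_pos ν').ne', hden, hnum, mul_div_mul_left _ _ hcpos.ne']
  -- sets of hyperedges which do not reach the disagreement do not contribute
  set 𝓑 := T.powerset.filter fun B => ∃ i ∈ I, s i ⊆ B
  have hzero : ∀ B ∈ T.powerset, B ∉ 𝓑 → ∫ q, J q * K B q ∂P = 0 := fun B hB hB' => by
    obtain ⟨C, hΔC, hC, hCB⟩ := hsep B (Finset.mem_powerset.1 hB) fun i hi hiB =>
      hB' (Finset.mem_filter.2 ⟨hB, i, hi, hiB⟩)
    -- The exchange on `C` preserves `P`, fixes `K B` and negates `J`, so the integral equals its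
    -- own negative.
    have hmp := measurePreserving_pairSwap χ hC
    have h1 : ∫ q, J (pairSwap C q) * K B (pairSwap C q) ∂P = ∫ q, J q * K B q ∂P := by
      rw [← integral_map hmp.measurable.aemeasurable (f := fun q => J q * K B q), hmp.map_eq]
      exact (hJ_meas.mul (hK_meas B)).aestronglyMeasurable
    have h2 : ∀ q, J (pairSwap C q) * K B (pairSwap C q) = -(J q * K B q) := fun q => by
      have hKq : K B (pairSwap C q) = K B q :=
        Finset.prod_congr rfl fun e he => hh.pairExcess_pairSwap (hCB e he) q
      have hJq : J (pairSwap C q) = - J q := by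
        simp only [hJ]
        rw [ho_congr _ _ (pairSwap_fst_of_subset hΔC q),
          ho_congr _ _ (pairSwap_snd_of_subset hΔC q)]
        ring
      rw [hKq, hJq]; ring
    simp_rw [h2] at h1
    rw [integral_neg] at h1
    linarith
  have hJW : ∫ q, J q * W q ∂P = ∑ B ∈ 𝓑, ∫ q, J q * K B q ∂P := by
    rw [Finset.sum_subset (Finset.filter_subset _ _) hzero,
      ← integral_finsetSum _ fun B _ => hJK_int B]
    exact integral_congr_ae (.of_forall fun q => by simp only [hW_exp, Finset.mul_sum])
  rw [hdiff, abs_div, abs_of_pos hWpos, div_le_iff₀ hWpos, hJW]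
  calc |∑ B ∈ 𝓑, ∫ q, J q * K B q ∂P| ≤ ∑ B ∈ 𝓑, |∫ q, J q * K B q ∂P| :=
        Finset.abs_sum_le_sum_abs _ _
    _ ≤ ∑ B ∈ 𝓑, ∫ q, K B q ∂P := by
        refine Finset.sum_le_sum fun B _ => (abs_integral_le_integral_abs).trans ?_
        refine integral_mono (hJK_int B).abs (hK_int B) fun q => ?_
        simp only [abs_mul, abs_of_nonneg (hK0 B q)]
        exact mul_le_of_le_one_left (hK0 B q) (hJ1 q)
    _ = ∫ q, ∑ B ∈ 𝓑, K B q ∂P := (integral_finsetSum _ fun B _ => hK_int B).symm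
    _ ≤ ∫ q, (∑ i ∈ I, ∏ e ∈ s i, p e) * W q ∂P := by
        refine integral_mono (integrable_finsetSum _ fun B _ => hK_int B)
          (hW_int.const_mul _) fun q => ?_
        -- Applied pointwise in `q` with the uniform bounds `p`: the path sum comes out of the
        -- integral and the remaining `∫ W` is the denominator.
        exact Finset.sum_prod_le_of_exists_subset T (fun e => pairExcess h m e q) p
          (fun e => hh.pairExcess_nonneg e q) (fun e => hh.pairExcess_le e q) 𝓑
          (Finset.filter_subset _ _) I s fun B hB => (Finset.mem_filter.1 hB).2
    _ = _ := integral_const_mul _ _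

end IsBoundedFamily

end RandomField

/-! ### Clusters in the line graph -/

namespace DependenceHypergraph

variable {V : Type*} (H : DependenceHypergraph V)

theorem finite_neighborSet (e : H.Edge) : (H.lineGraph.neighborSet e).Finite := by
  refine (H.finite_touching (H.finite_edge _ e.2).toFinset).subset ?_
  rintro e' ⟨-, x, hx, hx'⟩
  exact ⟨x, hx', by simpa using hx⟩

/-- The vertices of the hyperedges which are joined to `Δ` by a walk in the line graph inside
`B`, together with `Δ`. -/
def cluster (Δ : Finset V) (B : Finset H.Edge) : Set V :=
  Δ ∪ {x | ∃ e₀ ∈ H.touching Δ, ∃ (e : H.Edge) (w : H.lineGraph.Walk e₀ e),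
    (∀ z ∈ w.support, z ∈ B) ∧ x ∈ (e : Set V)}

variable {H}

/-- A hyperedge of `B` meeting the cluster either touches `Δ`, and is itself a starting point, or
meets a hyperedge already reached and prolongs its walk by one step. So none straddles the cluster.
-/
theorem subset_or_disjoint_cluster {Δ : Finset V} {B : Finset H.Edge} {e : H.Edge} (he : e ∈ B) :
    (e : Set V) ⊆ H.cluster Δ B ∨ Disjoint (e : Set V) (H.cluster Δ B) := by
  by_cases hd : Disjoint (e : Set V) (H.cluster Δ B)
  · exact Or.inr hd
  obtain ⟨x, hxe, hxC⟩ := Set.not_disjoint_iff.1 hd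
  refine Or.inl fun y hy => Or.inr ?_
  rcases hxC with hxΔ | ⟨e₀, he₀, e', w, hw, hx⟩
  · exact ⟨e, RandomField.mem_touching.2 ⟨x, hxΔ, hxe⟩, e, .nil, by simpa using he, hy⟩
  · by_cases hee : e' = e
    · subst hee
      exact ⟨e₀, he₀, e', w, hw, hy⟩
    · refine ⟨e₀, he₀, e, w.concat (show H.lineGraph.Adj e' e from ⟨hee, x, hx, hxe⟩), ?_, hy⟩
      intro z hz
      rw [SimpleGraph.Walk.support_concat, List.mem_append,
        List.mem_singleton] at hz
      rcases hz with hz | rfl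
      exacts [hw z hz, he]

/-- If `B` contains no simple path of length `N e₀` starting at a hyperedge `e₀` which touches
`Δ`, then the cluster of `Δ` in `B` lies in every set which contains the vertices of the
hyperedges at distance at most `N e₀` from such `e₀`. -/
theorem cluster_subset {Δ Λ : Finset V} (hΔ : Δ ⊆ Λ) {N : H.Edge → ℕ}
    (hΛ : ∀ e₀ ∈ H.touching Δ, ∀ n ≤ N e₀,
      ∀ l ∈ TemperedGraph.walkLists H.finite_neighborSet n e₀, ∀ e ∈ l, (e : Set V) ⊆ Λ)
    {B : Finset H.Edge}
    (hB : ∀ e₀ ∈ H.touching Δ,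
      ∀ l ∈ TemperedGraph.pathLists H.finite_neighborSet (N e₀) e₀, ¬ ∀ z ∈ l, z ∈ B) :
    H.cluster Δ B ⊆ Λ := by
  classical
  rintro x (hx | ⟨e₀, he₀, e, w, hw, hx⟩)
  · exact hΔ hx
  have hp := w.bypass_isPath
  have hpB : ∀ z ∈ w.bypass.support, z ∈ B := fun z hz => hw z (w.support_bypass_subset_support hz)
  set p := w.bypass
  by_cases hlen : p.length ≤ N e₀
  · exact hΛ e₀ he₀ _ hlen _ (TemperedGraph.support_mem_walkLists _ p) e p.end_mem_support hx
  -- The first `N e₀` steps of a longer simple path in `B` form a forbidden path.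
  · exfalso
    have hlen' : (p.take (N e₀)).length = N e₀ := by
      rw [SimpleGraph.Walk.take_length]; omega
    refine hB e₀ he₀ (p.take (N e₀)).support ?_ ?_
    · refine Finset.mem_filter.2 ⟨?_, _, p.take (N e₀), hp.take _, hlen', rfl⟩
      have := TemperedGraph.support_mem_walkLists H.finite_neighborSet (p.take (N e₀))
      rwa [hlen'] at this
    · intro z hz
      exact hpB z ((p.isSubwalk_take _).support_subset hz)

end DependenceHypergraph

/-! ### Uniform decay of boundary influence -/

namespace RandomField

variable {V S : Type*} [MeasurableSpace S] (χ : Measure S) [IsProbabilityMeasure χ]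
  {H : DependenceHypergraph V} {h : H.Edge → (V → S) → ℝ} {m M : H.Edge → ℝ}

-- Temperedness and the bound on `𝔇` apply to the same animal, of `N e k + 1` hyperedges: degrees
-- cost at most `exp (a (N + 1))`, weights gain `exp (-(a + ε)(N + 1))`.
open Classical in
theorem IsBoundedFamily.sum_pathLists_le_exp [Nonempty (V → S)] (hh : IsBoundedFamily H h m M)
    {g : ℕ → ℝ} (hg0 : 0 ≤ g 0) (hg_log : ∀ n : ℕ, 1 ≤ n → Real.log n ≤ g n)
    {a ε : ℝ} {N : H.Edge → ℕ → ℕ} (htemp : TemperedGraph.IsTemperedAlong H.lineGraph g a N)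
    (hweak : (⨆ e : H.Edge, ⨆ k : ℕ, ⨆ ϑ ∈ TemperedGraph.simplePaths H.lineGraph (N e k) e,
        weightAverage (oscillation m M)
          (TemperedGraph.pathAnimal H.lineGraph ϑ)) ≤ ((-(a + ε) : ℝ) : EReal))
    (e : H.Edge) (k : ℕ) :
    ∑ l ∈ TemperedGraph.pathLists H.finite_neighborSet (N e k) e,
        ∏ z ∈ l.toFinset, (Real.exp (2 * oscillation m M z) - 1) ≤
      Real.exp (-ε * (N e k + 1)) := by
  refine TemperedGraph.sum_pathLists_le _ _ _ _ _ (Real.exp_pos _).le fun y p hp hn => ?_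
  have hmem : (⟨y, p⟩ : Σ y, H.lineGraph.Walk e y) ∈
      TemperedGraph.simplePaths H.lineGraph (N e k) e := by
    rw [← hn]; exact TemperedGraph.mem_simplePaths_of_isPath p hp
  have hcard : ((TemperedGraph.pathAnimal H.lineGraph ⟨y, p⟩).card : ℝ) = N e k + 1 := by
    rw [TemperedGraph.card_pathAnimal p hp, hn]; push_cast; rfl
  have hw : weightAverage (oscillation m M) (TemperedGraph.pathAnimal H.lineGraph ⟨y, p⟩) ≤
      ((-(a + ε) : ℝ) : EReal) :=
    (iSup₂_le_iff.1 ((iSup_le_iff.1 ((iSup_le_iff.1 hweak) e)) k)) _ hmem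
  have h1 := prod_le_exp_of_weightAverage_le (fun z _ => hh.oscillation_nonneg z)
    ⟨e, hmem.2.2.1⟩ hw
  have h2 := htemp.prod_max_degree_le hg0 hg_log e k hmem.2
  rw [hcard] at h1 h2
  refine h1.trans ?_
  have h3 : Real.exp (-(a * (N e k + 1))) ≤ ∏ z ∈ TemperedGraph.pathAnimal H.lineGraph ⟨y, p⟩,
      TemperedGraph.invDegree H.lineGraph z := by
    simp only [TemperedGraph.invDegree]
    rw [Finset.prod_inv_distrib, Real.exp_neg]
    exact inv_anti₀ (Finset.prod_pos fun z _ => by positivity) h2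
  calc Real.exp (-(a + ε) * (N e k + 1))
      = Real.exp (-ε * (N e k + 1)) * Real.exp (-(a * (N e k + 1))) := by
        rw [← Real.exp_add]; ring_nf
    _ ≤ _ := by gcongr

/-- Uniform decay of the influence of the boundary condition, also for boundary conditions
which may disagree only on part of the exterior of `Λ`. -/
def HasUniformDecay (γ : Finset V → (V → S) → Measure (V → S)) : Prop :=
  ∀ (Δ : Finset V) (κ : ℝ), 0 < κ → ∃ Λ₀ : Finset V, Δ ⊆ Λ₀ ∧
    ∀ (Λ : Finset V) (ξ η : V → S), (∀ x ∈ Λ₀, x ∉ Λ → ξ x = η x) →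
      ∀ A : Set (V → S), MeasurableSet[cylinderEvents (X := fun _ : V => S) (Δ : Set V)] A →
        |(γ Λ ξ).real A - (γ Λ η).real A| ≤ κ

theorem IsBoundedFamily.hasUniformDecay (hh : IsBoundedFamily H h m M)
    {g : ℕ → ℝ} (hg0 : 0 ≤ g 0) (hg_log : ∀ n : ℕ, 1 ≤ n → Real.log n ≤ g n)
    {a ε : ℝ} {N : H.Edge → ℕ → ℕ} (htemp : TemperedGraph.IsTemperedAlong H.lineGraph g a N)
    (hε : 0 < ε)
    (hweak : (⨆ e : H.Edge, ⨆ k : ℕ, ⨆ ϑ ∈ TemperedGraph.simplePaths H.lineGraph (N e k) e,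
        weightAverage (oscillation m M)
          (TemperedGraph.pathAnimal H.lineGraph ϑ)) ≤ ((-(a + ε) : ℝ) : EReal)) :
    HasUniformDecay (specification χ H h) := by
  classical
  intro Δ κ hκ
  have : Nonempty S := nonempty_of_isProbabilityMeasure χ
  -- Only finitely many hyperedges touch `Δ`, so one `k` serves them all.
  have hlim : Filter.Tendsto (fun k : ℕ => ((H.touching Δ).card : ℝ) * Real.exp (-ε * k))
      Filter.atTop (nhds 0) := by
    have h1 : Filter.Tendsto (fun k : ℕ => -ε * (k : ℝ)) Filter.atTop Filter.atBot :=
      tendsto_natCast_atTop_atTop.const_mul_atTop_of_neg (by linarith)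
    simpa using (Real.tendsto_exp_atBot.comp h1).const_mul ((H.touching Δ).card : ℝ)
  obtain ⟨k, hk⟩ := (hlim.eventually (gt_mem_nhds hκ)).exists
  -- `Δ` and all sites of hyperedges within `N e₀ k` steps of some `e₀` touching `Δ`: a cluster
  -- without long paths stays inside.
  set Λ₀ : Finset V := Δ ∪ (H.touching Δ).biUnion fun e₀ =>
    (Finset.range (N e₀ k + 1)).biUnion fun n =>
      (TemperedGraph.walkLists H.finite_neighborSet n e₀).biUnion fun l =>
        l.toFinset.biUnion fun e => (H.finite_edge _ e.2).toFinset
  refine ⟨Λ₀, Finset.subset_union_left, fun Λ ξ η hξη A hA => ?_⟩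
  have hcl := fun B => DependenceHypergraph.cluster_subset (Δ := Δ) (Λ := Λ₀) (N := fun e => N e k)
    (B := B)
    Finset.subset_union_left (fun e₀ he₀ n hn l hl e he x hx => by
      refine Finset.mem_union_right _ ?_
      simp only [Finset.mem_biUnion]
      exact ⟨e₀, he₀, n, Finset.mem_range.2 (by omega), l, hl, e, List.mem_toFinset.2 he,
        by simpa using hx⟩)
  have := hh.abs_specification_sub_le χ (Λ := Λ) (ξ := ξ) (η := η) hA
    ((H.touching Δ).sigma fun e₀ => TemperedGraph.pathLists H.finite_neighborSet (N e₀ k) e₀)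
    (fun i => i.2.toFinset) (fun B _ hB => by
      refine ⟨H.cluster Δ B, Set.subset_union_left, fun x hx hxΛ => hξη x ?_ hxΛ,
        fun e he => DependenceHypergraph.subset_or_disjoint_cluster he⟩
      exact hcl B (fun e₀ he₀ l hl hlB => hB ⟨e₀, l⟩ (Finset.mem_sigma.2 ⟨he₀, hl⟩)
        fun z hz => hlB z (List.mem_toFinset.1 hz)) hx)
  refine this.trans ?_
  rw [Finset.sum_sigma]
  calc _ ≤ ∑ e ∈ H.touching Δ, Real.exp (-ε * k) := by
        refine Finset.sum_le_sum fun e _ =>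
          (hh.sum_pathLists_le_exp hg0 hg_log htemp hweak e k).trans (Real.exp_le_exp.2 ?_)
        -- A strictly increasing sequence of naturals satisfies `k ≤ N e k`, which makes the rate
        -- uniform in `e`.
        have h1 : (k : ℝ) ≤ N e k := by exact_mod_cast (htemp.1 e).le_apply
        nlinarith
    _ ≤ κ := by rw [Finset.sum_const, nsmul_eq_mul]; exact hk.le

end RandomField

/-! ### Limits of random fields -/

namespace MeasureTheory

open Filter Topology

/-- The real-valued measure is countably additive. -/
theorem tendsto_sum_measureReal_iUnion {Y : Type*} [MeasurableSpace Y] (μ : Measure Y)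
    [IsFiniteMeasure μ] {f : ℕ → Set Y} (hd : Pairwise (Function.onFun Disjoint f))
    (hf : ∀ n, MeasurableSet (f n)) :
    Tendsto (fun k => ∑ n ∈ Finset.range k, μ.real (f n)) atTop (𝓝 (μ.real (⋃ n, f n))) := by
  have h1 : HasSum (fun n => μ (f n)) (μ (⋃ n, f n)) := by
    rw [measure_iUnion hd hf]; exact ENNReal.summable.hasSum
  have h2 := (ENNReal.tendsto_toReal (measure_ne_top μ (⋃ n, f n))).comp h1.tendsto_sum_nat
  refine h2.congr fun k => ?_
  simp only [Function.comp]
  rw [ENNReal.toReal_sum fun n _ => measure_ne_top μ _]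
  rfl

/-- Convergence of probabilities extends from a π-system to the generated σ-algebra, if the
probabilities are Cauchy uniformly on that σ-algebra. -/
theorem tendsto_measureReal_of_generateFrom {Y ι : Type*} {m : MeasurableSpace Y}
    [mY : MeasurableSpace Y] {l : Filter ι}
    [l.NeBot] {Q : ι → Measure Y} [∀ i, IsProbabilityMeasure (Q i)] {ν : Measure Y}
    [IsProbabilityMeasure ν] (hm : m ≤ mY) {s : Set (Set Y)}
    (hs : m = MeasurableSpace.generateFrom s) (hpi : IsPiSystem s)
    (hlim : ∀ A ∈ s, Tendsto (fun i => (Q i).real A) l (𝓝 (ν.real A)))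
    (hQ : ∀ κ : ℝ, 0 < κ → ∀ᶠ i in l, ∀ᶠ j in l, ∀ A, MeasurableSet[m] A →
      |(Q i).real A - (Q j).real A| ≤ κ) {A : Set Y} (hA : MeasurableSet[m] A) :
    Tendsto (fun i => (Q i).real A) l (𝓝 (ν.real A)) := by
  induction A, hA using MeasurableSpace.induction_on_inter hs hpi with
  | empty => simp
  | basic A hA => exact hlim A hA
  | compl A hA ih =>
    simp_rw [probReal_compl_eq_one_sub (hm _ hA)]
    exact ih.const_sub 1
  | iUnion f hd hf ih =>
    have hf' : ∀ n, MeasurableSet (f n) := fun n => hm _ (hf n)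
    have key : ∀ κ : ℝ, 0 < κ → ∀ᶠ i in l, |(Q i).real (⋃ n, f n) - ν.real (⋃ n, f n)| ≤ κ := by
      intro κ hκ
      filter_upwards [hQ κ hκ] with i hi
      -- The Cauchy bound on finite unions, with `j` sent to the limit, is uniform in `k`; this is
      -- what lets `k → ∞` afterwards.
      have hk : ∀ k, |∑ n ∈ Finset.range k, (Q i).real (f n) -
          ∑ n ∈ Finset.range k, ν.real (f n)| ≤ κ := by
        intro k
        have h1 : Tendsto (fun j => |∑ n ∈ Finset.range k, (Q i).real (f n) -
            ∑ n ∈ Finset.range k, (Q j).real (f n)|) l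
            (𝓝 |∑ n ∈ Finset.range k, (Q i).real (f n) - ∑ n ∈ Finset.range k, ν.real (f n)|) :=
          ((tendsto_finsetSum _ fun n _ => ih n).const_sub _).abs
        refine le_of_tendsto h1 ?_
        filter_upwards [hi] with j hj
        have h2 := hj (⋃ n ∈ Finset.range k, f n)
          (@Finset.measurableSet_biUnion _ _ m _ _ fun n _ => hf n)
        rwa [measureReal_biUnion_finset (hd.set_pairwise _) fun n _ => hf' n,
          measureReal_biUnion_finset (hd.set_pairwise _) fun n _ => hf' n] at h2
      exact le_of_tendsto (((tendsto_sum_measureReal_iUnion (Q i) hd hf').sub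
        (tendsto_sum_measureReal_iUnion ν hd hf')).abs) (.of_forall hk)
    refine Metric.tendsto_nhds.2 fun κ hκ => ?_
    filter_upwards [key (κ / 2) (by positivity)] with i hi
    rw [Real.dist_eq]
    linarith

/-- A net of random fields which is Cauchy uniformly on every finite set of sites converges to a
random field. -/
theorem exists_tendsto_measureReal_of_cauchy {V S ι : Type*} [Countable V] [MeasurableSpace S]
    [StandardBorelSpace S] {l : Filter ι} [l.NeBot] (P : ι → Measure (V → S))
    [∀ i, IsProbabilityMeasure (P i)]
    (hP : ∀ (Δ : Finset V) (κ : ℝ), 0 < κ → ∀ᶠ i in l, ∀ᶠ j in l, ∀ A,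
      MeasurableSet[cylinderEvents (X := fun _ : V => S) (Δ : Set V)] A →
        |(P i).real A - (P j).real A| ≤ κ) :
    ∃ μ : Measure (V → S), IsProbabilityMeasure μ ∧ ∀ (Δ : Finset V) (κ : ℝ), 0 < κ →
      ∀ᶠ i in l, ∀ A, MeasurableSet[cylinderEvents (X := fun _ : V => S) (Δ : Set V)] A →
        |(P i).real A - μ.real A| ≤ κ := by
  -- A measurable embedding of `S` in the Cantor space makes the configuration space part of a
  -- compact one, on which probability measures are compact.
  set b : S → ℕ → Bool := MeasurableSpace.mapNatBool S
  have hb : MeasurableEmbedding b :=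
    (MeasurableSpace.measurable_mapNatBool S).measurableEmbedding
      (MeasurableSpace.injective_mapNatBool S)
  set j : (V → S) → V → ℕ → Bool := fun σ x => b (σ x)
  have hj_meas : Measurable j :=
    measurable_pi_lambda _ fun x => hb.measurable.comp (measurable_pi_apply x)
  have hj : MeasurableEmbedding j := hj_meas.measurableEmbedding fun σ τ h =>
    funext fun x => hb.injective (congrFun h x)
  have hQ : ∀ i, IsProbabilityMeasure ((P i).map j) := fun i =>
    Measure.isProbabilityMeasure_map hj_meas.aemeasurable
  set Q : ι → ProbabilityMeasure (V → ℕ → Bool) := fun i => ⟨(P i).map j, hQ i⟩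
  have hQreal : ∀ i {A}, MeasurableSet A → (Q i : Measure (V → ℕ → Bool)).real A =
      (P i).real (j ⁻¹' A) := fun i A hA => by
    simp only [Measure.real, Q, ProbabilityMeasure.coe_mk, Measure.map_apply hj_meas hA]
  -- events of `V → S` in `Δ` are the preimages of events in `Δ`
  have hpre : ∀ (Δ : Set V) (A : Set (V → ℕ → Bool)),
      MeasurableSet[cylinderEvents (X := fun _ : V => ℕ → Bool) Δ] A →
        MeasurableSet[cylinderEvents (X := fun _ : V => S) Δ] (j ⁻¹' A) := fun Δ A hA => by
    have hm : @Measurable _ _ (cylinderEvents (X := fun _ : V => S) Δ)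
        (cylinderEvents (X := fun _ : V => ℕ → Bool) Δ) j :=
      measurable_cylinderEvents_iff.2 fun x hx =>
        hb.measurable.comp (measurable_cylinderEvent_apply hx)
    exact hm hA
  have hpre' : ∀ (Δ : Set V) (A : Set (V → S)),
      MeasurableSet[cylinderEvents (X := fun _ : V => S) Δ] A →
        ∃ B, MeasurableSet[cylinderEvents (X := fun _ : V => ℕ → Bool) Δ] B ∧ j ⁻¹' B = A := by
    intro Δ A hA
    have : cylinderEvents (X := fun _ : V => S) Δ ≤
        (cylinderEvents (X := fun _ : V => ℕ → Bool) Δ).comap j := by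
      refine iSup₂_le fun x hx => ?_
      rw [← hb.comap_eq, MeasurableSpace.comap_comp, show (b ∘ fun σ : V → S => σ x) =
        (fun y : V → ℕ → Bool => y x) ∘ j from rfl, ← MeasurableSpace.comap_comp]
      exact MeasurableSpace.comap_mono (measurable_cylinderEvent_apply hx).comap_le
    exact this A hA
  obtain ⟨ν, -, hν⟩ := isCompact_univ.ultrafilter_le_nhds ((Ultrafilter.of l).map Q) (by simp)
  have hUl : ((Ultrafilter.of l : Ultrafilter ι) : Filter ι) ≤ l := Ultrafilter.of_le l
  have hν' : Tendsto Q (Ultrafilter.of l : Ultrafilter ι) (𝓝 ν) := hν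
  have hlimQ : ∀ (Δ : Finset V) (A : Set (V → ℕ → Bool)),
      MeasurableSet[cylinderEvents (X := fun _ : V => ℕ → Bool) (Δ : Set V)] A →
        Tendsto (fun i => (Q i : Measure (V → ℕ → Bool)).real A) (Ultrafilter.of l : Ultrafilter ι)
          (𝓝 ((ν : Measure (V → ℕ → Bool)).real A)) := by
    intro Δ A hA
    -- Clopen sets have empty frontier, so weak convergence gives convergence of their
    -- probabilities; the local ones generate the events in `Δ`.
    refine tendsto_measureReal_of_generateFrom (m := cylinderEvents (X := fun _ : V => ℕ → Bool)
      (Δ : Set V)) cylinderEvents_le_pi (s := {B | IsClopen B ∧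
        MeasurableSet[cylinderEvents (X := fun _ : V => ℕ → Bool) (Δ : Set V)] B})
      (le_antisymm ?_ (MeasurableSpace.generateFrom_le fun B hB => hB.2)) ?_ ?_ ?_ hA
    · refine iSup₂_le fun x hx => ?_
      rw [← measurable_iff_comap_le, @measurable_pi_iff]
      intro n t _
      refine MeasurableSpace.measurableSet_generateFrom ⟨?_, ?_⟩
      · exact (isClopen_discrete t).preimage (by fun_prop)
      · exact ((measurable_pi_apply n).comp (measurable_cylinderEvent_apply hx))
          (MeasurableSet.of_discrete)
    · exact fun B hB C hC _ => ⟨hB.1.inter hC.1, @MeasurableSet.inter _ (_) _ _ hB.2 hC.2⟩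
    · intro B hB
      have := ProbabilityMeasure.tendsto_measure_of_null_frontier_of_tendsto' hν'
        (E := B) (by simp [hB.1.frontier_eq])
      exact (ENNReal.tendsto_toReal (measure_ne_top _ _)).comp this
    · intro κ hκ
      filter_upwards [hUl (hP Δ κ hκ)] with i hi
      filter_upwards [hUl hi] with i' hi' B hB
      rw [hQreal i (cylinderEvents_le_pi _ hB), hQreal i' (cylinderEvents_le_pi _ hB)]
      exact hi' _ (hpre _ _ hB)
  -- No mass escapes from the image of `S`: leaving it at a single site is a local event of
  -- probability `0` for every `Q i`, hence for `ν`, and there are countably many sites.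
  have hrange : (ν : Measure (V → ℕ → Bool)) (Set.range j)ᶜ = 0 := by
    have h1 : (Set.range j)ᶜ = ⋃ x : V, (fun y : V → ℕ → Bool => y x) ⁻¹' (Set.range b)ᶜ := by
      ext y
      simp only [Set.mem_compl_iff, Set.mem_iUnion, Set.mem_preimage]
      rw [← not_forall, not_iff_not]
      constructor
      · rintro ⟨σ, rfl⟩ x
        exact ⟨σ x, rfl⟩
      · intro hy
        choose σ hσ using hy
        exact ⟨σ, funext hσ⟩
    rw [h1, measure_iUnion_null_iff]
    intro x
    have hx := hlimQ {x} ((fun y : V → ℕ → Bool => y x) ⁻¹' (Set.range b)ᶜ)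
      ((measurable_cylinderEvent_apply (X := fun _ : V => ℕ → Bool) (by simp))
        hb.measurableSet_range.compl)
    have h0 : ∀ i, (Q i : Measure (V → ℕ → Bool)).real
        ((fun y : V → ℕ → Bool => y x) ⁻¹' (Set.range b)ᶜ) = 0 := fun i => by
      rw [hQreal i ((measurable_pi_apply x) hb.measurableSet_range.compl)]
      have : j ⁻¹' ((fun y : V → ℕ → Bool => y x) ⁻¹' (Set.range b)ᶜ) = ∅ := by
        ext σ; simp [j]
      rw [this]; simp
    simp_rw [h0] at hx
    have := tendsto_nhds_unique hx tendsto_const_nhds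
    rwa [measureReal_eq_zero_iff] at this
  set μ : Measure (V → S) := (ν : Measure (V → ℕ → Bool)).comap j
  have hμ : ∀ B, MeasurableSet B → μ (j ⁻¹' B) = (ν : Measure (V → ℕ → Bool)) B := fun B hB => by
    rw [hj.comap_preimage]
    exact measure_inter_conull hrange
  refine ⟨μ, ⟨?_⟩, fun Δ κ hκ => ?_⟩
  · rw [← Set.preimage_univ (f := j), hμ _ MeasurableSet.univ]
    exact measure_univ
  · filter_upwards [hP Δ κ hκ] with i hi A hA
    have hU : Tendsto (fun i => (P i).real A) (Ultrafilter.of l : Ultrafilter ι)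
        (𝓝 (μ.real A)) := by
      obtain ⟨B, hB, rfl⟩ := hpre' _ _ hA
      have h1 := hlimQ Δ B hB
      have hB' := cylinderEvents_le_pi _ hB
      simp_rw [hQreal _ hB'] at h1
      rwa [Measure.real, hμ B hB']
    -- The Cauchy bound at `i` survives as the other index runs along the ultrafilter; thus
    -- convergence holds along `l` itself.
    exact le_of_tendsto ((hU.const_sub _).abs)
      ((hi.filter_mono hUl).mono fun i' hi' => hi' A hA)

end MeasureTheory

/-! ### Local events and conditional probabilities -/

namespace MeasureTheory

section CylinderEvents

variable {V S : Type*} [MeasurableSpace S]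

/-- The events observable in a finite part of `Δ`. -/
def localEvents (S : Type*) [MeasurableSpace S] (Δ : Set V) : Set (Set (V → S)) :=
  {A | ∃ Δ₀ : Finset V, (Δ₀ : Set V) ⊆ Δ ∧
    MeasurableSet[cylinderEvents (X := fun _ : V => S) (Δ₀ : Set V)] A}

theorem isPiSystem_localEvents (Δ : Set V) : IsPiSystem (localEvents S Δ) := by
  classical
  rintro A ⟨Δ₁, h₁, hA⟩ B ⟨Δ₂, h₂, hB⟩ -
  refine ⟨Δ₁ ∪ Δ₂, by simpa using ⟨h₁, h₂⟩, ?_⟩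
  exact @MeasurableSet.inter _ (_) _ _ (cylinderEvents_mono (by simp) _ hA)
    (cylinderEvents_mono (by simp) _ hB)

theorem cylinderEvents_eq_generateFrom (Δ : Set V) :
    cylinderEvents (X := fun _ : V => S) Δ = MeasurableSpace.generateFrom (localEvents S Δ) := by
  refine le_antisymm (iSup₂_le fun x hx => ?_)
    (MeasurableSpace.generateFrom_le fun A ⟨Δ₀, h₀, hA⟩ => cylinderEvents_mono h₀ _ hA)
  rw [← measurable_iff_comap_le]
  exact fun t ht => MeasurableSpace.measurableSet_generateFrom
    ⟨{x}, by simpa using hx, measurable_cylinderEvent_apply (X := fun _ : V => S) (by simp) ht⟩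

theorem ext_of_localEvents {μ ν : Measure (V → S)} [IsProbabilityMeasure μ]
    [IsProbabilityMeasure ν]
    (h : ∀ (Δ : Finset V) (A : Set (V → S)),
      MeasurableSet[cylinderEvents (X := fun _ : V => S) (Δ : Set V)] A → μ.real A = ν.real A) :
    μ = ν := by
  refine ext_of_generate_finite (localEvents S Set.univ) ?_ (isPiSystem_localEvents _) ?_
    (by simp)
  · rw [← cylinderEvents_univ, cylinderEvents_eq_generateFrom]
  · rintro A ⟨Δ, -, hA⟩
    have := h Δ A hA
    rwa [measureReal_eq_measureReal_iff] at this

end CylinderEvents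

/-- If two probability measures are uniformly close on a σ-algebra, then so are the integrals of
`[0, 1]`-valued measurable functions. -/
theorem abs_integral_sub_le_of_forall_measurableSet {Y : Type*} {m : MeasurableSpace Y}
    [mY : MeasurableSpace Y] (hm : m ≤ mY) {μ ν : Measure Y} [IsProbabilityMeasure μ]
    [IsProbabilityMeasure ν] {κ : ℝ} (h : ∀ A, MeasurableSet[m] A → |μ.real A - ν.real A| ≤ κ)
    {f : Y → ℝ} (hf : Measurable[m] f) (hf0 : ∀ y, 0 ≤ f y) (hf1 : ∀ y, f y ≤ 1) :
    |∫ y, f y ∂μ - ∫ y, f y ∂ν| ≤ κ := by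
  have hfm : Measurable f := hf.mono hm le_rfl
  have hint : ∀ ρ : Measure Y, [IsProbabilityMeasure ρ] → Integrable f ρ := fun ρ _ =>
    Integrable.of_bound hfm.aestronglyMeasurable 1 (.of_forall fun y => by
      rw [Real.norm_eq_abs, abs_of_nonneg (hf0 y)]; exact hf1 y)
  have hanti : ∀ ρ : Measure Y, [IsProbabilityMeasure ρ] →
      IntegrableOn (fun t => ρ.real {y | t ≤ f y}) (Set.Ioc (0 : ℝ) 1) := fun ρ _ => by
    refine Measure.integrableOn_of_bounded (M := 1) (by simp) ?_ ?_
    · refine (Antitone.measurable fun s t hst => ?_).aestronglyMeasurable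
      exact measureReal_mono fun y hy => hst.trans hy
    · exact .of_forall fun t => by
        rw [Real.norm_eq_abs, abs_of_nonneg measureReal_nonneg]; exact measureReal_le_one
  -- Layer-cake formula: both integrals are averages over `t ∈ (0, 1]` of probabilities of
  -- superlevel sets, which are events of `m`.
  rw [(hint μ).integral_eq_integral_Ioc_meas_le (.of_forall hf0) (.of_forall hf1),
    (hint ν).integral_eq_integral_Ioc_meas_le (.of_forall hf0) (.of_forall hf1),
    ← integral_sub (hanti μ) (hanti ν)]
  have := norm_setIntegral_le_of_norm_le_const (μ := volume) (s := Set.Ioc (0 : ℝ) 1)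
    (f := fun t => μ.real {y | t ≤ f y} - ν.real {y | t ≤ f y}) (C := κ) (by simp)
    fun t _ => h _ (hf measurableSet_Ici)
  simpa using this

section CondExp

variable {Y : Type*} {m m₁ m₂ m₃ : MeasurableSpace Y} [mY : MeasurableSpace Y] {μ : Measure Y}
  [IsProbabilityMeasure μ]

theorem integrable_indicator_one {A : Set Y} (hA : MeasurableSet A) :
    Integrable (A.indicator fun _ => (1 : ℝ)) μ :=
  (integrable_const 1).indicator hA

theorem abs_condExp_sub_le (hm : m ≤ mY) {f φ : Y → ℝ} (hf : Integrable f μ)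
    (hφ : Measurable[m] φ) (hφi : Integrable φ μ) {κ : ℝ}
    (h : ∀ y, |f y - φ y| ≤ κ) : ∀ᵐ y ∂μ, |(μ[f | m]) y - φ y| ≤ κ := by
  have h1 := ae_bdd_abs_condExp_of_ae_bdd_abs (m := m) (μ := μ) (R := κ) (f := f - φ)
    (.of_forall h)
  have h2 := condExp_sub (m := m) hf hφi
  rw [condExp_of_stronglyMeasurable hm hφ.stronglyMeasurable hφi] at h2
  filter_upwards [h1, h2] with y hy1 hy2
  rw [hy2] at hy1
  exact hy1

/-- Both sides are `∫ μ(A|m) μ(B|m) dμ`. This symmetry turns a statement about conditional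
probabilities of `A` into one additive in `A`. -/
theorem setIntegral_condExp_indicator_comm (hm : m ≤ mY) {A B : Set Y} (hA : MeasurableSet A)
    (hB : MeasurableSet B) :
    ∫ y in A, (μ⟦B | m⟧) y ∂μ = ∫ y in B, (μ⟦A | m⟧) y ∂μ := by
  have key : ∀ {A B : Set Y}, MeasurableSet A → MeasurableSet B →
      ∫ y in A, (μ⟦B | m⟧) y ∂μ = ∫ y, (μ⟦B | m⟧) y * (μ⟦A | m⟧) y ∂μ := by
    intro A B hA hB
    have hi : (fun y => A.indicator (μ⟦B | m⟧) y) =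
        (μ⟦B | m⟧) * A.indicator fun _ => (1 : ℝ) := by
      funext y
      by_cases hy : y ∈ A <;> simp [hy]
    have hint : Integrable ((μ⟦B | m⟧) * A.indicator fun _ => (1 : ℝ)) μ := by
      rw [← hi]; exact integrable_condExp.indicator hA
    rw [← integral_indicator hA, hi, ← integral_condExp hm]
    exact integral_congr_ae (condExp_mul_of_stronglyMeasurable_left stronglyMeasurable_condExp
      hint (integrable_indicator_one hA))
  rw [key hA hB, key hB hA]
  exact integral_congr_ae (.of_forall fun y => mul_comm _ _)

/-- If conditioning on `m₁` or on the coarser `m₂` gives the same probabilities for the events of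
a π-system, then also for the events of the σ-algebra generated by it. -/
theorem condExp_indicator_ae_eq_of_generateFrom (h₂₁ : m₂ ≤ m₁) (h₁ : m₁ ≤ mY) (h₃ : m₃ ≤ mY)
    {s : Set (Set Y)} (hs : m₃ = MeasurableSpace.generateFrom s) (hpi : IsPiSystem s)
    (h : ∀ A ∈ s, μ⟦A | m₁⟧ =ᵐ[μ] μ⟦A | m₂⟧) {A : Set Y} (hA : MeasurableSet[m₃] A) :
    μ⟦A | m₁⟧ =ᵐ[μ] μ⟦A | m₂⟧ := by
  have h₂ := h₂₁.trans h₁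
  -- For fixed `B` both sides are countably additive in `A`, so the identity spreads from the
  -- π-system.
  have key : ∀ B, MeasurableSet[m₁] B → ∫ y in A, (μ⟦B | m₂⟧) y ∂μ =
      ∫ y in A, B.indicator (fun _ => (1 : ℝ)) y ∂μ := by
    intro B hB
    have hB' := h₁ _ hB
    have hint1 : Integrable (μ⟦B | m₂⟧) μ := integrable_condExp
    have hint2 := integrable_indicator_one (μ := μ) hB'
    induction A, hA using MeasurableSpace.induction_on_inter hs hpi with
    | empty => simp
    | basic A hA =>
      have hA' : MeasurableSet A := h₃ _ (hs ▸ MeasurableSpace.measurableSet_generateFrom hA)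
      rw [setIntegral_condExp_indicator_comm h₂ hA' hB',
        ← setIntegral_congr_ae hB' ((h A hA).mono fun y hy _ => hy),
        setIntegral_condExp h₁ (integrable_indicator_one hA') hB,
        setIntegral_indicator hA', setIntegral_indicator hB', Set.inter_comm]
    | compl A hA ih =>
      have h1 := integral_add_compl (h₃ _ hA) hint1
      have h2 := integral_add_compl (h₃ _ hA) hint2
      rw [integral_condExp h₂] at h1
      linarith
    | iUnion f hd hf ih =>
      have h1 := hasSum_integral_iUnion (fun n => h₃ _ (hf n)) hd hint1.integrableOn
      have h2 := hasSum_integral_iUnion (fun n => h₃ _ (hf n)) hd hint2.integrableOn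
      simp_rw [ih] at h1
      exact h1.unique h2
  refine (ae_eq_condExp_of_forall_setIntegral_eq h₁ (integrable_indicator_one (h₃ _ hA))
    (fun B _ _ => integrable_condExp.integrableOn) (fun B hB _ => ?_)
    (stronglyMeasurable_condExp.mono h₂₁).aestronglyMeasurable).symm
  rw [setIntegral_condExp_indicator_comm h₂ (h₁ _ hB) (h₃ _ hA), key B hB,
    setIntegral_indicator (h₁ _ hB), setIntegral_indicator (h₃ _ hA), Set.inter_comm]

end CondExp

end MeasureTheory

/-! ### DLR equations, existence, uniqueness and the global Markov property -/

namespace RandomField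

variable {V S : Type*} [MeasurableSpace S] (χ : Measure S) [IsProbabilityMeasure χ]
  {H : DependenceHypergraph V} {h : H.Edge → (V → S) → ℝ} {m M : H.Edge → ℝ}

namespace IsBoundedFamily

variable (hh : IsBoundedFamily H h m M)
include hh

/-- The kernel `γ_Λ` only looks at the boundary condition on the hyperedges touching `Λ`. -/
theorem specification_apply_congr {Λ : Finset V} {ω τ : V → S}
    (hedge : ∀ e ∈ H.touching Λ, ∀ x ∈ (e : Set V), x ∉ Λ → ω x = τ x) {T : Set V}
    (hT : ∀ x ∈ T, x ∉ Λ → ω x = τ x) {A : Set (V → S)}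
    (hA : MeasurableSet[cylinderEvents (X := fun _ : V => S) T] A) :
    specification χ H h Λ ω A = specification χ H h Λ τ A := by
  have hA' := cylinderEvents_le_pi _ hA
  have hglue : ∀ {R : Set V}, (∀ x ∈ R, x ∉ Λ → ω x = τ x) → ∀ ζ, ∀ x ∈ R,
      glue Λ ω ζ x = glue Λ τ ζ x := fun hR ζ x hx => by
    by_cases hxΛ : x ∈ Λ
    · rw [glue_of_mem hxΛ, glue_of_mem hxΛ]
    · rw [glue_of_notMem hxΛ, glue_of_notMem hxΛ, hR x hx hxΛ]
  have hw : ∀ ζ, weight H h Λ (glue Λ ω ζ) = weight H h Λ (glue Λ τ ζ) := fun ζ => by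
    rw [weight, weight, preModification, preModification]
    congr 1
    exact Finset.prod_congr rfl fun e he => hh.edge_congr (hglue (hedge e he) ζ)
  have hA1 : ∀ ζ, A.indicator (1 : (V → S) → ℝ≥0∞) (glue Λ ω ζ) =
      A.indicator 1 (glue Λ τ ζ) := fun ζ => by
    have := dependsOn_of_measurableSet_cylinderEvents hA (hglue hT ζ)
    by_cases hζ : glue Λ ω ζ ∈ A
    · simp [hζ, this.1 hζ]
    · simp [hζ, mt this.2 hζ]
  have hmeas := measurable_one.indicator (f := (1 : (V → S) → ℝ≥0∞)) hA'
  have hwm : Measurable fun η => weight H h Λ η * A.indicator (1 : (V → S) → ℝ≥0∞) η :=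
    (hh.measurable_weight Λ).mul hmeas
  rw [← lintegral_indicator_one hA', ← lintegral_indicator_one hA',
    hh.lintegral_specification χ Λ ω hmeas, hh.lintegral_specification χ Λ τ hmeas,
    partition, partition, lintegral_indepKernel χ _ _ hwm, lintegral_indepKernel χ _ _ hwm,
    lintegral_indepKernel χ _ _ (hh.measurable_weight Λ),
    lintegral_indepKernel χ _ _ (hh.measurable_weight Λ)]
  simp_rw [hw, hA1]

theorem specification_apply_inter {Λ : Finset V} (σ : V → S) {A B : Set (V → S)}
    (hA : MeasurableSet A)
    (hB : MeasurableSet[cylinderEvents (X := fun _ : V => S) (Λ : Set V)ᶜ] B) :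
    specification χ H h Λ σ (A ∩ B) = specification χ H h Λ σ A * B.indicator 1 σ := by
  have hB' := cylinderEvents_le_pi _ hB
  rw [← lintegral_indicator_one hA, ← hh.lintegral_specification_mul χ Λ σ
    (measurable_one.indicator hA) (measurable_one.indicator hB') fun σ τ hστ => ?_,
    ← lintegral_indicator_one (hA.inter hB')]
  · refine lintegral_congr fun η => ?_
    rw [Set.inter_indicator_one]
    rfl
  · have := dependsOn_of_measurableSet_cylinderEvents hB (σ := σ) (τ := τ) fun x hx =>
      hστ x (by simpa using hx)
    by_cases hσ : σ ∈ B
    · simp [hσ, this.1 hσ]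
    · simp [hσ, mt this.2 hσ]

theorem specification_empty_apply (σ : V → S) {A : Set (V → S)} (hA : MeasurableSet A) :
    specification χ H h ∅ σ A = A.indicator 1 σ := by
  have := hh.isProbabilityMeasure_specification χ ∅ σ
  have hpi : cylinderEvents (X := fun _ : V => S) ((∅ : Finset V) : Set V)ᶜ =
      MeasurableSpace.pi := by simp
  simpa using hh.specification_apply_inter χ (Λ := ∅) σ MeasurableSet.univ (B := A)
    (by rw [hpi]; exact hA)

theorem integrable_specification_real (Λ : Finset V) {A : Set (V → S)} (hA : MeasurableSet A)
    (μ : Measure (V → S)) [IsFiniteMeasure μ] :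
    Integrable (fun σ => (specification χ H h Λ σ).real A) μ := by
  refine integrable_of_measurable_bounded μ
    (hh.measurable_specification_apply χ Λ hA).ennreal_toReal 1 fun σ => ?_
  have := hh.isProbabilityMeasure_specification χ Λ σ
  rw [abs_of_nonneg measureReal_nonneg]
  exact measureReal_le_one

theorem lintegral_specification_eq_ofReal_integral (Λ : Finset V) {A : Set (V → S)}
    (hA : MeasurableSet A) (μ : Measure (V → S)) [IsFiniteMeasure μ] :
    ∫⁻ σ, specification χ H h Λ σ A ∂μ =
      ENNReal.ofReal (∫ σ, (specification χ H h Λ σ).real A ∂μ) := by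
  rw [ofReal_integral_eq_lintegral_ofReal (hh.integrable_specification_real χ Λ hA μ)
    (.of_forall fun σ => measureReal_nonneg)]
  refine lintegral_congr fun σ => ?_
  have := hh.isProbabilityMeasure_specification χ Λ σ
  rw [ofReal_measureReal]

/-- The DLR equation in integrated form implies its conditional form. -/
theorem mem_specifiedBy {μ : Measure (V → S)} [IsProbabilityMeasure μ]
    (hμ : ∀ (Λ : Finset V) (A : Set (V → S)), MeasurableSet A →
      ∫ σ, (specification χ H h Λ σ).real A ∂μ = μ.real A) :
    μ ∈ specifiedBy (specification χ H h) := by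
  refine ⟨inferInstance, fun Λ _ A hA => ?_⟩
  refine (ae_eq_condExp_of_forall_setIntegral_eq cylinderEvents_le_pi
    (integrable_indicator_one hA)
    (fun B _ _ => (hh.integrable_specification_real χ Λ hA μ).integrableOn)
    (fun B hB _ => ?_) ?_).symm
  · have hB' := cylinderEvents_le_pi _ hB
    -- The integrated equation for `A ∩ B`, with `B` pulled out of `γ_Λ` by properness.
    rw [← integral_indicator hB', setIntegral_indicator hA, setIntegral_const, smul_eq_mul,
      mul_one, Set.inter_comm B A, ← hμ Λ (A ∩ B) (hA.inter hB')]
    refine integral_congr_ae (.of_forall fun σ => ?_)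
    simp only [Measure.real]
    rw [hh.specification_apply_inter χ σ hA hB]
    by_cases hσ : σ ∈ B <;> simp [hσ]
  · refine Measurable.aestronglyMeasurable ?_
    exact measurable_cylinderEvents_of_dependsOn
      (hh.measurable_specification_apply χ Λ hA).ennreal_toReal fun σ τ hστ => by
        rw [specification_congr χ fun x hx => hστ x (by simpa using hx)]

/-- The DLR equation also holds for `Λ = ∅`. -/
theorem condExp_ae_eq_of_mem_specifiedBy {μ : Measure (V → S)}
    (hμ : μ ∈ specifiedBy (specification χ H h)) (Λ : Finset V) {A : Set (V → S)}
    (hA : MeasurableSet A) :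
    μ⟦A | cylinderEvents (X := fun _ : V => S) (Λ : Set V)ᶜ⟧ =ᵐ[μ]
      fun σ => (specification χ H h Λ σ).real A := by
  have := hμ.1
  -- The empty volume does occur: `Λ₀ ∩ Δ` below may be empty.
  rcases Λ.eq_empty_or_nonempty with rfl | hΛ
  · have h1 : cylinderEvents (X := fun _ : V => S) ((∅ : Finset V) : Set V)ᶜ =
        MeasurableSpace.pi := by simp
    rw [h1, condExp_of_stronglyMeasurable le_rfl
      (measurable_const.indicator hA).stronglyMeasurable (integrable_indicator_one hA)]
    refine .of_forall fun σ => ?_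
    simp only [Measure.real]
    rw [hh.specification_empty_apply χ σ hA]
    by_cases hσ : σ ∈ A <;> simp [hσ]
  · exact hμ.2 Λ hΛ A hA

theorem integral_specification_of_mem_specifiedBy {μ : Measure (V → S)}
    (hμ : μ ∈ specifiedBy (specification χ H h)) (Λ : Finset V) {A : Set (V → S)}
    (hA : MeasurableSet A) :
    ∫ σ, (specification χ H h Λ σ).real A ∂μ = μ.real A := by
  have := hμ.1
  rw [← integral_congr_ae (hh.condExp_ae_eq_of_mem_specifiedBy χ hμ Λ hA),
    integral_condExp cylinderEvents_le_pi, integral_indicator_const _ hA, smul_eq_mul, mul_one]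

theorem integral_specification_specification {Λ Λ' : Finset V} (hΛ : Λ ⊆ Λ') (σ : V → S)
    {A : Set (V → S)} (hA : MeasurableSet A) :
    ∫ η, (specification χ H h Λ η).real A ∂(specification χ H h Λ' σ) =
      (specification χ H h Λ' σ).real A := by
  have := hh.isProbabilityMeasure_specification χ Λ' σ
  have h1 := hh.lintegral_lintegral_specification χ hΛ σ (measurable_one.indicator hA)
  simp only [lintegral_indicator_one hA] at h1
  rw [hh.lintegral_specification_eq_ofReal_integral χ Λ hA] at h1
  rw [Measure.real, ← h1, ENNReal.toReal_ofReal (integral_nonneg fun _ => measureReal_nonneg)]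

theorem abs_integral_specification_sub_le (Λ : Finset V) {A : Set (V → S)}
    (hA : MeasurableSet A) (μ : Measure (V → S)) [IsProbabilityMeasure μ] {c κ : ℝ}
    (hc : ∀ σ, |(specification χ H h Λ σ).real A - c| ≤ κ) :
    |∫ σ, (specification χ H h Λ σ).real A ∂μ - c| ≤ κ := by
  have h1 : ∫ σ, (specification χ H h Λ σ).real A ∂μ - c =
      ∫ σ, ((specification χ H h Λ σ).real A - c) ∂μ := by
    rw [integral_sub (hh.integrable_specification_real χ Λ hA μ) (integrable_const c)]
    simp
  rw [h1]
  simpa using norm_integral_le_of_norm_le_const (μ := μ) (C := κ)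
    (f := fun σ => (specification χ H h Λ σ).real A - c) (.of_forall hc)

theorem exists_mem_specifiedBy [Countable V] [StandardBorelSpace S]
    (hdecay : HasUniformDecay (specification χ H h)) :
    ∃ μ, μ ∈ specifiedBy (specification χ H h) := by
  classical
  have : Nonempty S := nonempty_of_isProbabilityMeasure χ
  obtain ⟨ξ⟩ : Nonempty (V → S) := inferInstance
  have hprob := fun Λ σ => hh.isProbabilityMeasure_specification χ Λ σ
  obtain ⟨μ, hμp, hμ⟩ := exists_tendsto_measureReal_of_cauchy (l := Filter.atTop)
    (fun Λ : Finset V => specification χ H h Λ ξ) (by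
      intro Δ κ hκ
      obtain ⟨Λ₀, -, h₀⟩ := hdecay Δ (κ / 2) (by positivity)
      have hc : ∀ Λ : Finset V, Λ₀ ⊆ Λ → ∀ A,
          MeasurableSet[cylinderEvents (X := fun _ : V => S) (Δ : Set V)] A →
          |(specification χ H h Λ ξ).real A - (specification χ H h Λ₀ ξ).real A| ≤ κ / 2 := by
        intro Λ hΛ A hA
        have hA' := cylinderEvents_le_pi _ hA
        -- By consistency `γ_Λ` is an average of `γ_Λ₀`; in the volume `Λ₀` the required agreement
        -- on `Λ₀ \ Λ₀` is vacuous.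
        rw [← hh.integral_specification_specification χ hΛ ξ hA']
        exact hh.abs_integral_specification_sub_le χ Λ₀ hA' _ fun σ =>
          h₀ Λ₀ σ ξ (fun x hx hx' => absurd hx hx') A hA
      filter_upwards [Filter.eventually_ge_atTop Λ₀] with Λ hΛ
      filter_upwards [Filter.eventually_ge_atTop Λ₀] with Λ' hΛ' A hA
      have h1 := hc Λ hΛ A hA
      have h2 := hc Λ' hΛ' A hA
      rw [abs_le] at h1 h2 ⊢
      constructor <;> linarith)
  refine ⟨μ, hh.mem_specifiedBy χ fun Λ A hA => ?_⟩
  -- the law obtained by resampling `Λ` coincides with `μ` on local events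
  set ρ : Measure (V → S) := μ.bind (specification χ H h Λ)
  have hρ : ∀ B, MeasurableSet B → ρ B = ∫⁻ σ, specification χ H h Λ σ B ∂μ := fun B hB =>
    Measure.bind_apply hB (hh.measurable_specification χ Λ).aemeasurable
  have hρp : IsProbabilityMeasure ρ := ⟨by rw [hρ _ MeasurableSet.univ]; simp⟩
  have hρreal : ∀ B, MeasurableSet B →
      ρ.real B = ∫ σ, (specification χ H h Λ σ).real B ∂μ := fun B hB => by
    rw [Measure.real, hρ B hB, hh.lintegral_specification_eq_ofReal_integral χ Λ hB,
      ENNReal.toReal_ofReal (integral_nonneg fun _ => measureReal_nonneg)]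
  have hρμ : ρ = μ := by
    refine ext_of_localEvents fun Δ B hB => ?_
    have hB' := cylinderEvents_le_pi _ hB
    rw [hρreal B hB']
    -- `γ_Λ(B|·)` only reads `Δ` and the hyperedges touching `Λ`, so it is a local function and its
    -- integral can be approximated in `γ_Λ'(·|ξ)`, where consistency applies.
    set T : Finset V := Δ ∪ (H.touching Λ).biUnion fun e => (H.finite_edge _ e.2).toFinset
    have hf : Measurable[cylinderEvents (X := fun _ : V => S) (T : Set V)]
        fun σ => (specification χ H h Λ σ).real B := by
      refine measurable_cylinderEvents_of_dependsOn
        (hh.measurable_specification_apply χ Λ hB').ennreal_toReal fun σ τ hστ => ?_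
      simp only [Measure.real]
      rw [hh.specification_apply_congr χ (fun e he x hx _ => hστ x ?_)
        (fun x hx _ => hστ x ?_) hB]
      · refine Finset.mem_union_right _ (Finset.mem_biUnion.2 ⟨e, he, by simpa using hx⟩)
      · exact Finset.mem_union_left _ hx
    refine eq_of_abs_sub_le_all fun κ hκ => ?_
    obtain ⟨Λ', h1, h2, hΛΛ'⟩ := ((hμ T (κ / 2) (by positivity)).and
      ((hμ Δ (κ / 2) (by positivity)).and (Filter.eventually_ge_atTop Λ))).exists
    have h3 := abs_integral_sub_le_of_forall_measurableSet cylinderEvents_le_pi h1 hf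
      (fun _ => measureReal_nonneg) (fun σ => measureReal_le_one)
    rw [hh.integral_specification_specification χ hΛΛ' ξ hB'] at h3
    have h4 := h2 B hB
    rw [abs_le] at h3 h4 ⊢
    constructor <;> linarith
  rw [← hρreal A hA, hρμ]

theorem subsingleton_specifiedBy (hdecay : HasUniformDecay (specification χ H h)) :
    (specifiedBy (specification χ H h)).Subsingleton := by
  intro μ hμ ν hν
  have := hμ.1
  have := hν.1
  obtain ⟨ξ⟩ := nonempty_of_isProbabilityMeasure μ
  refine ext_of_localEvents fun Δ A hA => eq_of_abs_sub_le_all fun κ hκ => ?_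
  have hA' := cylinderEvents_le_pi _ hA
  obtain ⟨Λ₀, -, h₀⟩ := hdecay Δ (κ / 2) (by positivity)
  have hc : ∀ σ, |(specification χ H h Λ₀ σ).real A - (specification χ H h Λ₀ ξ).real A| ≤ κ / 2 :=
    fun σ => h₀ Λ₀ σ ξ (fun x hx hx' => absurd hx hx') A hA
  have h1 := hh.abs_integral_specification_sub_le χ Λ₀ hA' μ hc
  have h2 := hh.abs_integral_specification_sub_le χ Λ₀ hA' ν hc
  rw [hh.integral_specification_of_mem_specifiedBy χ hμ Λ₀ hA'] at h1
  rw [hh.integral_specification_of_mem_specifiedBy χ hν Λ₀ hA'] at h2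
  rw [abs_le] at h1 h2 ⊢
  constructor <;> linarith

theorem isGloballyMarkov (hdecay : HasUniformDecay (specification χ H h)) {μ : Measure (V → S)}
    (hμ : μ ∈ specifiedBy (specification χ H h)) : IsGloballyMarkov H μ := by
  classical
  have := hμ.1
  obtain ⟨s⟩ := nonempty_of_isProbabilityMeasure μ
  intro Δ A hA
  have hbd : H.boundary Δ ⊆ Δᶜ := fun y hy => hy.1
  refine condExp_indicator_ae_eq_of_generateFrom (cylinderEvents_mono hbd) cylinderEvents_le_pi
    cylinderEvents_le_pi (cylinderEvents_eq_generateFrom Δ) (isPiSystem_localEvents Δ) ?_ hA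
  rintro B ⟨Δ₀, hΔ₀, hB⟩
  have hB' := cylinderEvents_le_pi _ hB
  have key : ∀ κ : ℝ, 0 < κ → ∀ᵐ σ ∂μ,
      |(μ⟦B | cylinderEvents (X := fun _ : V => S) Δᶜ⟧) σ -
        (μ⟦B | cylinderEvents (X := fun _ : V => S) (H.boundary Δ)⟧) σ| ≤ κ := by
    intro κ hκ
    obtain ⟨Λ₀, -, h₀⟩ := hdecay Δ₀ (κ / 2) (by positivity)
    -- A finite volume inside `Δ`; sites of `Λ₀` outside it lie off `Δ`, where `σ` and `r σ` agree.
    -- This is why decay must tolerate disagreement everywhere off `Λ₀ \ Λ`.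
    set Λ := Λ₀.filter (· ∈ Δ)
    have hΛΔ : (Λ : Set V) ⊆ Δ := fun x hx => (Finset.mem_filter.1 hx).2
    set r : (V → S) → V → S := fun σ x => if x ∈ Δ then s x else σ x
    have hr : Measurable r := measurable_pi_lambda _ fun x => by
      by_cases hx : x ∈ Δ <;> simp only [r, hx, if_true, if_false] <;> fun_prop
    set f : (V → S) → ℝ := fun σ => (specification χ H h Λ σ).real B
    set φ : (V → S) → ℝ := fun σ => f (r σ)
    have hf : Measurable f := (hh.measurable_specification_apply χ Λ hB').ennreal_toReal
    have hfi : Integrable f μ := hh.integrable_specification_real χ Λ hB' μ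
    -- With `Δ` overwritten by `s`, only `∂Δ` is left to matter: hyperedges touching `Λ ⊆ Δ` leave
    -- `Δ` only through `∂Δ`.
    have hφ : Measurable[cylinderEvents (X := fun _ : V => S) (H.boundary Δ)] φ := by
      refine measurable_cylinderEvents_of_dependsOn (hf.comp hr) fun σ τ hστ => ?_
      simp only [φ, f, Measure.real]
      rw [hh.specification_apply_congr χ ?_ ?_ hB]
      · intro e he x hx _
        by_cases hxΔ : x ∈ Δ
        · simp [r, hxΔ]
        · obtain ⟨y, hy, hye⟩ := mem_touching.1 he
          simpa [r, hxΔ] using hστ x ⟨hxΔ, y, hΛΔ hy, e, e.2, hye, hx⟩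
      · intro x hx _
        simp [r, hΔ₀ hx]
    have hfφ : ∀ σ, |f σ - φ σ| ≤ κ / 2 := fun σ => h₀ Λ σ (r σ) (fun x hx hxΛ => by
      have hxΔ : x ∉ Δ := fun hxΔ => hxΛ (Finset.mem_filter.2 ⟨hx, hxΔ⟩)
      simp [r, hxΔ]) B hB
    have hφi : Integrable φ μ := by
      refine integrable_of_measurable_bounded μ (hf.comp hr) 1 fun σ => ?_
      have := hh.isProbabilityMeasure_specification χ Λ (r σ)
      simp only [φ, f]
      rw [abs_of_nonneg measureReal_nonneg]
      exact measureReal_le_one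
    have hclose : ∀ Δ' : Set V, H.boundary Δ ⊆ Δ' → Δ' ⊆ Δᶜ → ∀ᵐ σ ∂μ,
        |(μ⟦B | cylinderEvents (X := fun _ : V => S) Δ'⟧) σ - φ σ| ≤ κ / 2 := by
      intro Δ' h1 h2
      -- As `Δ' ⊆ Λᶜ`, the tower property makes `μ(B|ℱ_Δ')` the conditional expectation of `f`,
      -- which is within `κ / 2` of the `ℱ_Δ'`-measurable `φ`.
      have htower : μ[f | cylinderEvents (X := fun _ : V => S) Δ'] =ᵐ[μ]
          μ⟦B | cylinderEvents (X := fun _ : V => S) Δ'⟧ :=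
        (condExp_congr_ae (hh.condExp_ae_eq_of_mem_specifiedBy χ hμ Λ hB').symm).trans
          (condExp_condExp_of_le (cylinderEvents_mono (h2.trans (Set.compl_subset_compl.2 hΛΔ)))
            cylinderEvents_le_pi)
      filter_upwards [htower, abs_condExp_sub_le cylinderEvents_le_pi hfi
        (hφ.mono (cylinderEvents_mono h1) le_rfl) hφi hfφ] with σ hσ1 hσ2
      rwa [hσ1] at hσ2
    filter_upwards [hclose Δᶜ hbd le_rfl, hclose (H.boundary Δ) le_rfl hbd] with σ h1 h2
    rw [abs_le] at h1 h2 ⊢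
    constructor <;> linarith
  have hall : ∀ᵐ σ ∂μ, ∀ n : ℕ,
      |(μ⟦B | cylinderEvents (X := fun _ : V => S) Δᶜ⟧) σ -
        (μ⟦B | cylinderEvents (X := fun _ : V => S) (H.boundary Δ)⟧) σ| ≤ 1 / ((n : ℝ) + 1) :=
    ae_all_iff.2 fun n => key _ (by positivity)
  filter_upwards [hall] with σ hσ
  refine eq_of_abs_sub_le_all fun κ hκ => ?_
  obtain ⟨n, hn⟩ := exists_nat_one_div_lt hκ
  exact (hσ n).trans hn.le

end IsBoundedFamily

end RandomField

end

theorem theorem1 {V S : Type*} [Countable V] [MeasurableSpace S] [StandardBorelSpace S]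
    (χ : Measure S) [IsProbabilityMeasure χ]
    (H : DependenceHypergraph V)
    (h : H.Edge → (V → S) → ℝ) (m M : H.Edge → ℝ)
    (hh : RandomField.IsBoundedFamily H h m M)
    (g : ℕ → ℝ) (hg_nonneg : ∀ n, 0 ≤ g n) (hg_mono : StrictMonoOn g (Set.Ici 1))
    (hg_log : ∀ n : ℕ, 1 ≤ n → Real.log n ≤ g n)
    (a : ℝ) (ha : 0 < a) (N : H.Edge → ℕ → ℕ)
    (htemp : TemperedGraph.IsTemperedAlong H.lineGraph g a N)
    (ε : ℝ) (hε : 0 < ε)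
    (hweak : (⨆ e : H.Edge, ⨆ k : ℕ, ⨆ ϑ ∈ TemperedGraph.simplePaths H.lineGraph (N e k) e,
        RandomField.weightAverage (RandomField.oscillation m M)
          (TemperedGraph.pathAnimal H.lineGraph ϑ)) ≤ ((-(a + ε) : ℝ) : EReal)) :
    ∃ μ : Measure (V → S),
      RandomField.specifiedBy (RandomField.specification χ H h) = {μ} ∧
        RandomField.IsGloballyMarkov H μ := by
  have hdecay := hh.hasUniformDecay χ (hg_nonneg 0) hg_log htemp hε hweak
  obtain ⟨μ, hμ⟩ := hh.exists_mem_specifiedBy χ hdecay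
  exact ⟨μ, (hh.subsingleton_specifiedBy χ hdecay).eq_singleton_of_mem hμ,
    hh.isGloballyMarkov χ hdecay hμ⟩
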